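/- Let $q\ge 2$ and $M\ge 3$ be integers. For $K\ge 1$ put $N=qK$. The ensemble of repeat-multiple-accumulate (RMA) codes of rate $R=1/q\le 1/2$ with $M$ accumulators consists of the binary codes obtained by encoding $K$ bits as follows: repeat every bit $q$ times, and then, for $\ell=1,\dots,M$, permute the resulting word of length $N$ by an interleaver $\pi_\ell$ and pass it through the accumulator $1/(1+D)$; the $M$ interleavers are independent and uniformly distributed over all permutations of $N$ symbols. Let $d_{\min}$ be the minimum weight of a nonzero codeword. Let $H(x)=-x\ln x-(1-x)\ln(1-x)$ and, for $\boldsymbol\gamma=(\beta_0,\dots,\beta_M)$ with $\beta_0=\alpha$ and $\beta_M=\rho$, $$f(\boldsymbol\gamma)=\frac{H(\alpha)}{q}-\sum_{\ell=1}^{M}H(\beta_\ell)+\sum_{\ell=1}^{M}H\!\left(\frac{\beta_\ell-\beta_{\ell-1}/2}{1-\beta_{\ell-1}}\right)(1-\beta_{\ell-1})+\ln 2\sum_{\ell=0}^{M-1}\beta_\ell ,$$ where a term with $\beta_{\ell-1}=1$ in the second sum is read as $0$. Let $\mathcal G_M(\rho)$ be the set of $\boldsymbol\gamma$ with $\beta_M=\rho$,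 $\beta_0>0$ and $\beta_{\ell-1}\le 2\min(\beta_\ell,1-\beta_\ell)$ for $1\le\ell\le M$. Let $\hat\rho_{\min}$ be the largest $r\le 1/2$ such that $f<0$ on $\mathcal G_M(\rho)$ for all $0<\rho<r$. Then: 1. $\hat\rho_{\min}>0$, and almost all codes in the ensemble have minimum distance growing linearly with $N$, with asymptotic growth rate coefficient at least $\hat\rho_{\min}$: for every $r<\hat\rho_{\min}$, the fraction of codes in the ensemble with $d_{\min}\ge rN$ tends to $1$ as $N=qK\to\infty$. 2. The bound is obtained by finding the maximum of $f$, that is, by solving the system $$\beta_1=\frac12-\frac{1-\alpha}{2}\sqrt{1-\left(\frac{\alpha}{1-\alpha}\right)^{2/q}},\qquad \beta_{\ell+1}=\frac12-\frac{1-\beta_\ell}{2}\sqrt{1-\left(\frac{1-\beta_\ell}{\beta_\ell}\cdot\frac{\beta_\ell-\beta_{\ell-1}/2}{1-\beta_\ell-\beta_{\ell-1}/2}\right)^2}\quad(1\le\ell\le M-1)$$ with $0<\alpha\le 1/2$. Precisely: for $0<\rho\le 1/2$, if $f\ge 0$ somewhere on $\mathcal G_M(\rho)$ then $f$ attains a maximum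 on $\mathcal G_M(\rho)$, and every maximizer of $f$ on $\mathcal G_M(\rho)$ solves the system; the maximum of $f$ on $\mathcal G_M(\hat\rho_{\min})$ is $0$; and $\hat\rho_{\min}$ is the smallest value of $\beta_M$ among the solutions of the system with $f(\boldsymbol\gamma)=0$. -/

import Mathlib

/-! ## Repeat-multiple-accumulate codes -/

/-- The rate `1/q` repetition code on `K` information bits: every bit is repeated `q` times,
giving a word of length `N = K * q`. -/
def repeatWord {K : ℕ} (q : ℕ) (u : Fin K → ZMod 2) : Fin (K * q) → ZMod 2 :=
  fun i => u i.divNat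

/-- The accumulator, i.e. the rate-one convolutional encoder with generator `1 / (1 + D)`:
the `i`-th output bit is the sum modulo 2 of the first input bits up to and including the
`i`-th one. -/
def accumulate {N : ℕ} (v : Fin N → ZMod 2) : Fin N → ZMod 2 :=
  fun i => ∑ j ∈ Finset.Iic i, v j

/-- The encoder with `M` accumulators: repetition, followed by `M` stages, each of which
permutes its input by the interleaver `π ℓ` and then accumulates it. -/
def rmaEncode {K q : ℕ} : (M : ℕ) → (Fin M → Equiv.Perm (Fin (K * q))) →
    (Fin K → ZMod 2) → (Fin (K * q) → ZMod 2)
  | 0, _, u => repeatWord q u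
  | M + 1, π, u =>
      accumulate (fun i => rmaEncode M (fun ℓ => π ℓ.castSucc) u (π (Fin.last M) i))

/-- The code obtained from the interleavers `π`: the set of all codewords. -/
def rmaCode {K q M : ℕ} (π : Fin M → Equiv.Perm (Fin (K * q))) : Set (Fin (K * q) → ZMod 2) :=
  Set.range (rmaEncode M π)

/-- Minimum distance of a binary linear code: the least Hamming weight of a nonzero codeword. -/
noncomputable def codeMinDist {N : ℕ} (C : Set (Fin N → ZMod 2)) : ℕ :=
  sInf {d : ℕ | ∃ c ∈ C, c ≠ 0 ∧ hammingNorm c = d}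

/-- The fraction of codes with property `P` in the ensemble with `M` accumulators, repetition
factor `q` and `K` information bits; all tuples of interleavers are equally likely. -/
noncomputable def rmaFraction (q M K : ℕ) (P : Set (Fin (K * q) → ZMod 2) → Prop) : ℝ :=
  (Nat.card {π : Fin M → Equiv.Perm (Fin (K * q)) // P (rmaCode π)} : ℝ) /
    (Nat.card (Fin M → Equiv.Perm (Fin (K * q))) : ℝ)

/-! ## The exponent of the average weight enumerator -/

/-- The exponent `f(γ)`, for the vector `γ = (β₀ = α, β₁, …, β_M = ρ)` of normalized weights.
`Real.binEntropy` is the binary entropy function with natural logarithms. -/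
noncomputable def rmaExponent (q M : ℕ) (γ : Fin (M + 1) → ℝ) : ℝ :=
  Real.binEntropy (γ 0) / q
    - ∑ ℓ : Fin M, Real.binEntropy (γ ℓ.succ)
    + ∑ ℓ : Fin M, Real.binEntropy ((γ ℓ.succ - γ ℓ.castSucc / 2) / (1 - γ ℓ.castSucc))
        * (1 - γ ℓ.castSucc)
    + Real.log 2 * ∑ ℓ : Fin M, γ ℓ.castSucc

/-- The admissible vectors of normalized weights with positive input weight `α` and with final
weight `ρ`: each stage satisfies `β_{ℓ-1} ≤ 2 min (β_ℓ, 1 - β_ℓ)`. -/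
def rmaRegion (M : ℕ) (ρ : ℝ) : Set (Fin (M + 1) → ℝ) :=
  {γ | 0 < γ 0 ∧ γ (Fin.last M) = ρ ∧
    ∀ ℓ : Fin M, γ ℓ.castSucc ≤ 2 * min (γ ℓ.succ) (1 - γ ℓ.succ)}

/-- The recursive system of stationary-point equations, with `0 < α ≤ 1/2`. -/
def SolvesRmaSystem (q M : ℕ) (γ : Fin (M + 1) → ℝ) : Prop :=
  0 < γ 0 ∧ γ 0 ≤ 1 / 2 ∧
  (∀ h : 1 < M + 1,
    γ ⟨1, h⟩ = 1 / 2 - (1 - γ 0) / 2 *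
      Real.sqrt (1 - (γ 0 / (1 - γ 0)) ^ ((2 : ℝ) / (q : ℝ)))) ∧
  (∀ (ℓ : ℕ) (h0 : ℓ < M + 1) (h1 : ℓ + 1 < M + 1) (h2 : ℓ + 2 < M + 1),
    γ ⟨ℓ + 2, h2⟩ = 1 / 2 - (1 - γ ⟨ℓ + 1, h1⟩) / 2 *
      Real.sqrt (1 - ((1 - γ ⟨ℓ + 1, h1⟩) / γ ⟨ℓ + 1, h1⟩ *
        ((γ ⟨ℓ + 1, h1⟩ - γ ⟨ℓ, h0⟩ / 2) /
          (1 - γ ⟨ℓ + 1, h1⟩ - γ ⟨ℓ, h0⟩ / 2))) ^ 2))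

/-- The lower bound on the growth rate coefficient: the largest `r ≤ 1/2` such that the exponent
is negative at every admissible vector whose final weight lies strictly between `0` and `r`.
(The set contains `0` and is bounded above.) -/
noncomputable def rmaGrowthBound (q M : ℕ) : ℝ :=
  sSup {r : ℝ | r ≤ 1 / 2 ∧
    ∀ ρ : ℝ, 0 < ρ → ρ < r → ∀ γ ∈ rmaRegion M ρ, rmaExponent q M γ < 0}

/-!
A word of weight `w` that is uniformly permuted and accumulated gets weight `h` with probability
`transProb N w h`, and `weightCount_le` bounds it by `C(N - h, ⌊w/2⌋) C(h, ⌈w/2⌉) / C(N, w)`. On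
the exponential scale this is `stepExponent (w/N) (h/N)`, so that `rmaExponent` is the exponent of
the expected number of codewords along a chain of weights.

*The exponent.* Written with `x log x` terms, the exponent is continuous on the whole space
(`chainExponent`), and the closure of the admissible region is compact. Gibbs' inequality gives
`stepExponent a b ≤ (a/2) log (4 b (1 - b)) ≤ 0`. Hence the exponent is nonpositive if the input
weight is zero, and it is negative as soon as `β₂` is small (`chainExponent_neg_of_small`). The
latter shows that the growth rate bound is positive, and, for `M ≥ 3`, that the input weight
cannot tend to zero when the exponent approaches zero near the bound, so that the value zero is
attained there (`exists_zero`). A maximizer is an interior point, because the entropy terms have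
infinite slope at the boundary (`interior_of_isMaxOn`); the vanishing of the partial derivatives
is the recursive system (`solves_of_isMaxOn`). Conversely every solution of the system is
admissible (`mem_rmaRegion_of_solves`), so none with exponent zero ends below the bound.

*The codes.* By the first moment method it suffices that the expected number of codewords of
weight at most `r N` tends to zero. It is split according to the input weight `w` of the last
accumulator. If `w` has linear order, the exponent is at most a negative constant by compactness
(`exists_relaxed_bound`), which beats all polynomial factors. For smaller weights polynomial
factors matter. There the expected number of words after the first accumulator is at most
exponential in their weight (`meanCount_one_le`), and every further accumulator reduces it to
`O(h / N)` (`linBounded`); with `M ≥ 3` this applies to the input of the last accumulator. So weights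
`w` up to `N ^ (1/4)` contribute little in total, and for larger `w` the last transition itself
has probability at most `2 (N + 1) (4 r (1 - r)) ^ ⌊w/2⌋` (`transProb_le_geom`).
-/

namespace RMA

open Filter Topology

/-! ### The exponent as a continuous function -/

/-- The exponential growth rate of the probability that an accumulator maps an input of normalized
weight `a` to an output of normalized weight `b`. In terms of `Real.negMulLog` it is a continuous
function of all real `a`, `b`; in particular nothing special happens at `a = 1`. -/
noncomputable def stepExponent (a b : ℝ) : ℝ :=
  Real.negMulLog (b - a / 2) + Real.negMulLog (1 - b - a / 2) - Real.negMulLog (1 - a)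
    - Real.binEntropy b + a * Real.log 2

/-- The exponent of the average weight enumerator, as a sum over the accumulators. It is continuous
everywhere and agrees with `rmaExponent` on the admissible vectors. -/
noncomputable def chainExponent (q M : ℕ) (γ : Fin (M + 1) → ℝ) : ℝ :=
  Real.binEntropy (γ 0) / q + ∑ ℓ : Fin M, stepExponent (γ ℓ.castSucc) (γ ℓ.succ)

/-- The closure of the union of all `rmaRegion M ρ`: input weight `0` is allowed, and the final
weight is free. -/
def closedRegion (M : ℕ) : Set (Fin (M + 1) → ℝ) :=
  {γ | 0 ≤ γ 0 ∧ ∀ ℓ : Fin M, γ ℓ.castSucc ≤ 2 * min (γ ℓ.succ) (1 - γ ℓ.succ)}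

lemma step_iff {a b : ℝ} : a ≤ 2 * min b (1 - b) ↔ a ≤ 2 * b ∧ a ≤ 2 * (1 - b) := by
  rw [mul_min_of_nonneg _ _ (by norm_num : (0 : ℝ) ≤ 2), le_min_iff]

@[fun_prop]
lemma continuous_chainExponent (q M : ℕ) : Continuous (chainExponent q M) := by
  unfold chainExponent stepExponent
  fun_prop

lemma rmaRegion_subset {M : ℕ} {ρ : ℝ} {γ : Fin (M + 1) → ℝ} (h : γ ∈ rmaRegion M ρ) :
    γ ∈ closedRegion M := ⟨h.1.le, h.2.2⟩

lemma closedRegion_nonneg {M : ℕ} {γ : Fin (M + 1) → ℝ} (h : γ ∈ closedRegion M)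
    (i : Fin (M + 1)) : 0 ≤ γ i := by
  induction i using Fin.induction with
  | zero => exact h.1
  | succ i ih => linarith [(step_iff.1 (h.2 i)).1]

lemma closedRegion_le_one {M : ℕ} (hM : 1 ≤ M) {γ : Fin (M + 1) → ℝ} (h : γ ∈ closedRegion M)
    (i : Fin (M + 1)) : γ i ≤ 1 := by
  induction i using Fin.cases with
  | zero =>
    have := step_iff.1 (h.2 ⟨0, hM⟩)
    have h0 : (⟨0, hM⟩ : Fin M).castSucc = 0 := rfl
    rw [h0] at this
    linarith [this.1, this.2]
  | succ i =>
    have := (step_iff.1 (h.2 i)).2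
    linarith [closedRegion_nonneg h i.castSucc]

lemma isCompact_closedRegion {M : ℕ} (hM : 1 ≤ M) : IsCompact (closedRegion M) := by
  have hcl : IsClosed (closedRegion M) := by
    unfold closedRegion
    simp only [Set.ofPred_and, Set.ofPred_forall]
    refine (isClosed_le continuous_const (by fun_prop)).inter (isClosed_iInter fun ℓ => ?_)
    exact isClosed_le (by fun_prop) (by fun_prop)
  refine (isCompact_Icc (a := (0 : Fin (M + 1) → ℝ)) (b := 1)).of_isClosed_subset hcl ?_
  exact fun γ h => ⟨fun i => closedRegion_nonneg h i, fun i => closedRegion_le_one hM h i⟩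

/-- Each stage at most halves the weight. -/
lemma closedRegion_le_pow {M : ℕ} {γ : Fin (M + 1) → ℝ} (h : γ ∈ closedRegion M) (k : ℕ) :
    ∀ (i : ℕ) (hi : i + k < M + 1), γ ⟨i, by omega⟩ ≤ 2 ^ k * γ ⟨i + k, hi⟩ := by
  induction k with
  | zero => intro i hi; simp
  | succ k ih =>
    intro i hi
    have h1 := ih i (by omega)
    have h2 := (step_iff.1 (h.2 ⟨i + k, by omega⟩)).1
    have e1 : (⟨i + k, by omega⟩ : Fin M).castSucc = ⟨i + k, by omega⟩ := rfl
    have e2 : (⟨i + k, by omega⟩ : Fin M).succ = ⟨i + (k + 1), hi⟩ := rfl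
    rw [e1, e2] at h2
    calc _ ≤ _ := h1
      _ ≤ 2 ^ k * (2 * γ ⟨i + (k + 1), hi⟩) := by gcongr
      _ = _ := by ring

lemma stepExponent_eq {a b : ℝ} (ha : 0 ≤ a) (h : a ≤ 2 * min b (1 - b)) :
    stepExponent a b = - Real.binEntropy b
      + Real.binEntropy ((b - a / 2) / (1 - a)) * (1 - a) + a * Real.log 2 := by
  obtain ⟨h1, h2⟩ := step_iff.1 h
  unfold stepExponent
  rcases eq_or_ne a 1 with rfl | ha1
  · have hb : b = 1 / 2 := by linarith
    subst hb
    norm_num [Real.negMulLog]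
  · have hc : 1 - a ≠ 0 := sub_ne_zero.2 ha1.symm
    have key : ∀ u : ℝ, Real.negMulLog (u / (1 - a)) * (1 - a)
        = Real.negMulLog u + u * Real.log (1 - a) := by
      intro u
      rcases eq_or_ne u 0 with rfl | hu
      · simp
      · unfold Real.negMulLog
        rw [Real.log_div hu hc]
        field_simp
        ring
    have e : 1 - (b - a / 2) / (1 - a) = (1 - b - a / 2) / (1 - a) := by
      field_simp; ring
    rw [Real.binEntropy_eq_negMulLog_add_negMulLog_one_sub ((b - a / 2) / (1 - a)), add_mul, e,
      key, key]
    have : Real.negMulLog (1 - a) = -(1 - a) * Real.log (1 - a) := rfl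
    rw [this]
    ring

lemma rmaExponent_eq {q M : ℕ} {γ : Fin (M + 1) → ℝ} (h : γ ∈ closedRegion M) :
    rmaExponent q M γ = chainExponent q M γ := by
  unfold rmaExponent chainExponent
  rw [Finset.sum_congr rfl fun ℓ _ => stepExponent_eq (closedRegion_nonneg h ℓ.castSucc) (h.2 ℓ)]
  simp only [Finset.sum_add_distrib, Finset.sum_neg_distrib, Finset.mul_sum, mul_comm]
  ring

/-! ### Bounds on the exponent of one accumulator -/

lemma negMulLog_le {u x : ℝ} (hu : 0 ≤ u) (hx : 0 < x) :
    Real.negMulLog u ≤ - u * Real.log x + (x - u) := by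
  rcases hu.eq_or_lt with rfl | hu
  · simp [hx.le]
  · have h := Real.log_le_sub_one_of_pos (div_pos hx hu)
    rw [Real.log_div hx.ne' hu.ne'] at h
    have h2 := mul_le_mul_of_nonneg_left h hu.le
    have h3 : u * (x / u - 1) = x - u := by field_simp
    unfold Real.negMulLog
    nlinarith

/-- Gibbs' inequality, for two nonnegative masses `u`, `v` and a probability `p`. -/
lemma gibbs {u v p : ℝ} (hu : 0 ≤ u) (hv : 0 ≤ v) (hp : 0 < p) (hp1 : p < 1) :
    Real.negMulLog u + Real.negMulLog v - Real.negMulLog (u + v)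
      ≤ - u * Real.log p - v * Real.log (1 - p) := by
  rcases (add_nonneg hu hv).eq_or_lt with h | hc
  · have h1 : u = 0 := by linarith
    have h2 : v = 0 := by linarith
    simp [h1, h2]
  · have hp2 : 0 < 1 - p := by linarith
    have k1 := negMulLog_le hu (mul_pos hp hc)
    have k2 := negMulLog_le hv (mul_pos hp2 hc)
    rw [Real.log_mul hp.ne' hc.ne'] at k1
    rw [Real.log_mul hp2.ne' hc.ne'] at k2
    have : Real.negMulLog (u + v) = -(u + v) * Real.log (u + v) := rfl
    rw [this]
    nlinarith

/-- Gibbs' inequality for the conditional weight distribution. -/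
lemma stepExponent_le {a b : ℝ} (ha : 0 ≤ a) (h : a ≤ 2 * min b (1 - b)) :
    stepExponent a b ≤ a / 2 * Real.log (4 * b * (1 - b)) := by
  obtain ⟨h1, h2⟩ := step_iff.1 h
  rcases ha.eq_or_lt with rfl | ha
  · simp [stepExponent, Real.binEntropy_eq_negMulLog_add_negMulLog_one_sub]
  have hb : 0 < b := by linarith
  have hb1 : 0 < 1 - b := by linarith
  have hlog : Real.log (4 * b * (1 - b)) = 2 * Real.log 2 + Real.log b + Real.log (1 - b) := by
    rw [Real.log_mul (by positivity) hb1.ne', Real.log_mul (by norm_num) hb.ne',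
      show (4 : ℝ) = 2 ^ 2 by norm_num, Real.log_pow]
    push_cast; ring
  have hH : Real.binEntropy b = - b * Real.log b - (1 - b) * Real.log (1 - b) := by
    rw [Real.binEntropy_eq_negMulLog_add_negMulLog_one_sub]; unfold Real.negMulLog; ring
  rw [hlog]
  unfold stepExponent
  rw [hH]
  have k := gibbs (u := b - a / 2) (v := 1 - b - a / 2) (by linarith) (by linarith) hb (by linarith)
  rw [show b - a / 2 + (1 - b - a / 2) = 1 - a by ring] at k
  linarith

lemma four_mul_le_one (b : ℝ) : 4 * b * (1 - b) ≤ 1 := by nlinarith [sq_nonneg (2 * b - 1)]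

lemma stepExponent_nonpos {a b : ℝ} (ha : 0 ≤ a) (h : a ≤ 2 * min b (1 - b)) :
    stepExponent a b ≤ 0 := by
  obtain ⟨h1, h2⟩ := step_iff.1 h
  refine (stepExponent_le ha h).trans (mul_nonpos_of_nonneg_of_nonpos (by linarith) ?_)
  refine Real.log_nonpos ?_ (four_mul_le_one b)
  have : 0 ≤ b := by linarith
  have : 0 ≤ 1 - b := by linarith
  positivity

lemma chainExponent_nonpos_of_zero {q M : ℕ} {γ : Fin (M + 1) → ℝ} (h : γ ∈ closedRegion M)
    (h0 : γ 0 = 0) : chainExponent q M γ ≤ 0 := by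
  unfold chainExponent
  rw [h0, Real.binEntropy_zero, zero_div, zero_add]
  exact Finset.sum_nonpos fun ℓ _ => stepExponent_nonpos (closedRegion_nonneg h _) (h.2 ℓ)

/-- With input weight zero the exponent vanishes only if the last accumulator has input weight zero
too, provided that the final weight is below one half. -/
lemma chainExponent_neg_of_zero {q M : ℕ} {γ : Fin (M + 2) → ℝ} (h : γ ∈ closedRegion (M + 1))
    (h0 : γ 0 = 0) (hl : γ (Fin.last (M + 1)) < 1 / 2) (hp : 0 < γ (Fin.last M).castSucc) :
    chainExponent q (M + 1) γ < 0 := by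
  unfold chainExponent
  rw [h0, Real.binEntropy_zero, zero_div, zero_add, Fin.sum_univ_castSucc]
  have h1 : ∑ ℓ : Fin M, stepExponent (γ ℓ.castSucc.castSucc) (γ ℓ.castSucc.succ) ≤ 0 :=
    Finset.sum_nonpos fun ℓ _ => stepExponent_nonpos (closedRegion_nonneg h _) (h.2 ℓ.castSucc)
  have h2 := stepExponent_le hp.le (h.2 (Fin.last M))
  have h3 := (step_iff.1 (h.2 (Fin.last M))).1
  rw [Fin.succ_last] at h2 h3 ⊢
  set b := γ (Fin.last (M + 1))
  have hb : 0 < b := by linarith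
  have : Real.log (4 * b * (1 - b)) < 0 := by
    refine Real.log_neg ?_ ?_
    · have : 0 < 1 - b := by linarith
      positivity
    · nlinarith [sq_pos_of_pos (show 0 < 1 - 2 * b by linarith)]
  have := mul_neg_of_pos_of_neg (half_pos hp) this
  linarith

lemma binEntropy_le {a : ℝ} (ha1 : a ≤ 1) :
    Real.binEntropy a ≤ a * (1 - Real.log a) := by
  rw [Real.binEntropy_eq_negMulLog_add_negMulLog_one_sub]
  have := Real.negMulLog_le_one_sub_self (x := 1 - a) (by linarith)
  have e : Real.negMulLog a = -a * Real.log a := rfl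
  rw [e]
  linarith

/-- Two accumulators already beat the entropy of the input if the output of the second one has small
weight. -/
lemma chainExponent_neg_of_small {q M : ℕ} (hq : 2 ≤ q) {γ : Fin (M + 3) → ℝ}
    (h : γ ∈ closedRegion (M + 2)) (h0 : 0 < γ 0) (hs : γ 2 < Real.exp (-4) / 4) :
    chainExponent q (M + 2) γ < 0 := by
  have ha1 : γ 0 ≤ 1 := closedRegion_le_one (by omega) h 0
  unfold chainExponent
  rw [Fin.sum_univ_succ, Fin.sum_univ_succ]
  have hr : ∑ i : Fin M, stepExponent (γ i.succ.succ.castSucc) (γ i.succ.succ.succ) ≤ 0 :=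
    Finset.sum_nonpos fun ℓ _ => stepExponent_nonpos (closedRegion_nonneg h _) (h.2 _)
  have s1 := h.2 0
  have s2 := h.2 1
  have e0 : (0 : Fin (M + 2)).castSucc = 0 := rfl
  have e1 : (0 : Fin (M + 2)).succ = 1 := rfl
  have e2 : (1 : Fin (M + 2)).castSucc = 1 := rfl
  have e3 : (1 : Fin (M + 2)).succ = 2 := rfl
  have e4 : (Fin.succ 0 : Fin (M + 2)) = 1 := rfl
  rw [e0, e1] at s1
  rw [e2, e3] at s2
  rw [e0, e1, e4, e2, e3]
  set a := γ 0
  set b := γ 1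
  set c := γ 2
  obtain ⟨s11, s12⟩ := step_iff.1 s1
  obtain ⟨s21, s22⟩ := step_iff.1 s2
  have hb : 0 < b := by linarith
  have hc : 0 < c := by linarith
  have hb1 : b ≤ 1 := by linarith
  have hc1 : c < 1 := by linarith
  have g1 := stepExponent_le h0.le s1
  have g2 := stepExponent_le hb.le s2
  have l1 : Real.log (4 * b * (1 - b)) ≤ Real.log (4 * b) := by
    rcases eq_or_ne b 1 with h1 | h1
    · simp only [h1]; norm_num; exact Real.log_nonneg (by norm_num)
    · have : 0 < 1 - b := lt_of_le_of_ne (by linarith) (fun h => h1 (by linarith))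
      exact Real.log_le_log (by positivity) (by nlinarith)
  have l2 : Real.log (4 * c * (1 - c)) < -4 := by
    have h1c : 0 < 1 - c := by linarith
    rw [Real.log_lt_iff_lt_exp (by positivity)]
    nlinarith [Real.exp_pos (-4)]
  -- the input entropy is at most half of the bound `a (1 - log a)` since `q ≥ 2`
  have hH : Real.binEntropy a / q ≤ a * (1 - Real.log a) / 2 := by
    have hpos : 0 ≤ a * (1 - Real.log a) :=
      mul_nonneg h0.le (by linarith [Real.log_nonpos h0.le ha1])
    have hq' : (2 : ℝ) ≤ q := by exact_mod_cast hq
    exact (div_le_div_of_nonneg_right (binEntropy_le ha1) (by positivity)).trans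
      (div_le_div_of_nonneg_left hpos (by norm_num) hq')
  have l3 : Real.log (4 * b) - Real.log a ≤ 4 * b / a - 1 := by
    rw [← Real.log_div (by positivity) h0.ne']
    exact Real.log_le_sub_one_of_pos (by positivity)
  have l4 : a * (4 * b / a - 1) = 4 * b - a := by field_simp
  have l5 := mul_le_mul_of_nonneg_left l3 h0.le
  have l6 := mul_le_mul_of_nonneg_left l1 h0.le
  have l7 := mul_lt_mul_of_pos_left l2 hb
  nlinarith

/-! ### The growth rate bound -/

lemma rmaGrowthBound_le_half (q M : ℕ) : rmaGrowthBound q M ≤ 1 / 2 :=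
  csSup_le ⟨0, by norm_num, fun _ h1 h2 => absurd h1 h2.not_gt⟩ fun _ h => h.1

lemma le_rmaGrowthBound {q M : ℕ} {r : ℝ} (hr : r ≤ 1 / 2)
    (h : ∀ ρ : ℝ, 0 < ρ → ρ < r → ∀ γ ∈ rmaRegion M ρ, rmaExponent q M γ < 0) :
    r ≤ rmaGrowthBound q M :=
  le_csSup ⟨1 / 2, fun _ h => h.1⟩ ⟨hr, h⟩

lemma rmaExponent_neg {q M : ℕ} {ρ : ℝ} (h0 : 0 < ρ) (h : ρ < rmaGrowthBound q M)
    {γ : Fin (M + 1) → ℝ} (hγ : γ ∈ rmaRegion M ρ) : rmaExponent q M γ < 0 := by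
  obtain ⟨r, hr, hρ⟩ := exists_lt_of_lt_csSup
    (⟨0, by norm_num, fun _ h1 h2 => absurd h1 h2.not_gt⟩ : Set.Nonempty {r : ℝ | r ≤ 1 / 2 ∧
    ∀ ρ : ℝ, 0 < ρ → ρ < r → ∀ γ ∈ rmaRegion M ρ, rmaExponent q M γ < 0}) h
  exact hr.2 ρ h0 hρ γ hγ

lemma last_pos {M : ℕ} {γ : Fin (M + 1) → ℝ} (h : γ ∈ closedRegion M) (h0 : 0 < γ 0) :
    0 < γ (Fin.last M) := by
  have := closedRegion_le_pow h M 0 (by omega)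
  have e : (⟨0 + M, by omega⟩ : Fin (M + 1)) = Fin.last M := by ext; simp
  rw [e] at this
  have e' : (⟨0, by omega⟩ : Fin (M + 1)) = 0 := rfl
  rw [e'] at this
  by_contra hn
  nlinarith [show (0 : ℝ) < 2 ^ M by positivity]

theorem rmaGrowthBound_pos {q M : ℕ} (hq : 2 ≤ q) (hM : 2 ≤ M) : 0 < rmaGrowthBound q M := by
  obtain ⟨M, rfl⟩ : ∃ m, M = m + 2 := ⟨M - 2, by omega⟩
  have hpos : 0 < min (1 / 2) (Real.exp (-4) / 4 / 2 ^ M) := by positivity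
  refine hpos.trans_le (le_rmaGrowthBound (min_le_left _ _) fun ρ h0 hρ γ hγ => ?_)
  have hc := rmaRegion_subset hγ
  rw [rmaExponent_eq hc]
  refine chainExponent_neg_of_small hq hc hγ.1 ?_
  have h1 := closedRegion_le_pow hc M 2 (by omega)
  have e : (⟨2 + M, by omega⟩ : Fin (M + 3)) = Fin.last (M + 2) := by ext; simp; omega
  rw [e, hγ.2.1] at h1
  have h2 := hρ.trans_le (min_le_right _ _)
  rw [lt_div_iff₀ (by positivity)] at h2
  calc γ 2 ≤ 2 ^ M * ρ := h1
    _ < _ := by linarith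

lemma smul_mem_rmaRegion {M : ℕ} {ρ s : ℝ} (hs : 0 < s) (hs1 : s ≤ 1) {γ : Fin (M + 1) → ℝ}
    (h : γ ∈ rmaRegion M ρ) : s • γ ∈ rmaRegion M (s * ρ) := by
  refine ⟨mul_pos hs h.1, by simp [h.2.1], fun ℓ => step_iff.2 ?_⟩
  obtain ⟨h1, h2⟩ := step_iff.1 (h.2.2 ℓ)
  simp only [Pi.smul_apply, smul_eq_mul]
  constructor <;> nlinarith

/-- At the growth rate bound itself the exponent is still nonpositive: an admissible vector is a
limit of multiples of itself, whose final weights are smaller. -/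
lemma rmaExponent_nonpos {q M : ℕ} {γ : Fin (M + 1) → ℝ}
    (h : γ ∈ rmaRegion M (rmaGrowthBound q M)) : rmaExponent q M γ ≤ 0 := by
  have hc := rmaRegion_subset h
  have hpos : 0 < rmaGrowthBound q M := h.2.1 ▸ last_pos hc h.1
  rw [rmaExponent_eq hc]
  have ht : Tendsto (fun s : ℝ => chainExponent q M (s • γ)) (𝓝[<] 1)
      (𝓝 (chainExponent q M γ)) := by
    have hcont : Continuous (fun s : ℝ => chainExponent q M (s • γ)) := by fun_prop
    have := (hcont.tendsto 1).mono_left (nhdsWithin_le_nhds (s := Set.Iio 1))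
    simpa using this
  refine le_of_tendsto ht ?_
  filter_upwards [Ioo_mem_nhdsLT (show (0 : ℝ) < 1 by norm_num)] with s hs
  have hm := smul_mem_rmaRegion hs.1 hs.2.le h
  rw [← rmaExponent_eq (rmaRegion_subset hm)]
  exact (rmaExponent_neg (mul_pos hs.1 hpos) (by nlinarith [hs.2]) hm).le

lemma rmaGrowthBound_lt_half {q M : ℕ} (hq : 2 ≤ q) : rmaGrowthBound q M < 1 / 2 := by
  refine lt_of_le_of_ne (rmaGrowthBound_le_half q M) fun he => ?_
  have hm : (fun _ => 1 / 2 : Fin (M + 1) → ℝ) ∈ rmaRegion M (rmaGrowthBound q M) := by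
    rw [he]
    refine ⟨by norm_num, rfl, fun ℓ => by norm_num⟩
  have h := rmaExponent_nonpos hm
  rw [rmaExponent_eq (rmaRegion_subset hm)] at h
  -- every accumulator preserves the weight distribution `1 / 2`, so only the input entropy remains
  have hs : stepExponent (1 / 2) (1 / 2) = 0 := by
    have h4 : Real.log 4 = 2 * Real.log 2 := by
      rw [show (4 : ℝ) = 2 ^ 2 by norm_num, Real.log_pow]; norm_num
    have h2 : Real.binEntropy (1 / 2) = Real.log 2 := by
      rw [one_div, Real.binEntropy_two_inv]
    unfold stepExponent
    rw [h2]
    unfold Real.negMulLog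
    norm_num
    rw [show (1 / 4 : ℝ) = 4⁻¹ by norm_num, show (1 / 2 : ℝ) = 2⁻¹ by norm_num, Real.log_inv,
      Real.log_inv, h4]
    ring
  unfold chainExponent at h
  simp only [hs, Finset.sum_const_zero, add_zero] at h
  have : 0 < Real.binEntropy (1 / 2) / q :=
    div_pos (Real.binEntropy_pos (by norm_num) (by norm_num)) (by positivity)
  linarith

/-- The exponent reaches zero at the growth rate bound. The zero is a limit of admissible vectors
with nonnegative exponent; their second intermediate weight is bounded below, and with three
accumulators this prevents the input weight from tending to zero. -/
theorem exists_zero {q M : ℕ} (hq : 2 ≤ q) (hM : 3 ≤ M) :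
    ∃ γ ∈ rmaRegion M (rmaGrowthBound q M), rmaExponent q M γ = 0 := by
  obtain ⟨M, rfl⟩ : ∃ m, M = m + 3 := ⟨M - 3, by omega⟩
  set R := rmaGrowthBound q (M + 3)
  have hlt : R < 1 / 2 := rmaGrowthBound_lt_half hq
  have hex : ∀ n : ℕ, ∃ γ ∈ closedRegion (M + 3), 0 < γ 0 ∧
      γ (Fin.last _) < R + (1 / 2 - R) / (n + 1) ∧ 0 ≤ chainExponent q (M + 3) γ := by
    intro n
    by_contra hn
    push Not at hn
    have hp : 0 < (1 / 2 - R) / (n + 1) := by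
      have : 0 < 1 / 2 - R := by linarith
      positivity
    have hle : (1 / 2 - R) / (n + 1) ≤ 1 / 2 - R :=
      div_le_self (by linarith) (by linarith [show (0 : ℝ) ≤ n by positivity])
    have := le_rmaGrowthBound (q := q) (M := M + 3) (r := R + (1 / 2 - R) / (n + 1))
      (by linarith) fun ρ _ hρ γ hγ => by
        rw [rmaExponent_eq (rmaRegion_subset hγ)]
        exact hn γ (rmaRegion_subset hγ) hγ.1 (by rw [hγ.2.1]; exact hρ)
    linarith
  choose g hg h0 hl hf using hex
  obtain ⟨γ, hγ, φ, hφ, ht⟩ := (isCompact_closedRegion (by omega)).tendsto_subseq hg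
  have htc := tendsto_pi_nhds.1 ht
  have hF : 0 ≤ chainExponent q (M + 3) γ :=
    ge_of_tendsto' (((continuous_chainExponent q (M + 3)).tendsto γ).comp ht) fun n => hf _
  have h2 : Real.exp (-4) / 4 ≤ γ 2 := by
    refine ge_of_tendsto' (htc 2) fun n => ?_
    by_contra hn
    exact absurd (chainExponent_neg_of_small hq (hg _) (h0 _) (not_le.1 hn)) (hf _).not_gt
  have hlast : γ (Fin.last _) ≤ R := by
    have hb : Tendsto (fun n : ℕ => R + (1 / 2 - R) / ((n : ℝ) + 1)) atTop (𝓝 (R + 0)) := by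
      refine tendsto_const_nhds.add ?_
      have := (tendsto_one_div_add_atTop_nhds_zero_nat (𝕜 := ℝ)).const_mul (1 / 2 - R)
      simpa [div_eq_mul_inv] using this
    rw [add_zero] at hb
    exact le_of_tendsto_of_tendsto' (htc (Fin.last _)) (hb.comp hφ.tendsto_atTop)
      fun n => (hl _).le
  have hγ0 : 0 < γ 0 := by
    refine lt_of_le_of_ne hγ.1 fun he => hF.not_gt ?_
    refine chainExponent_neg_of_zero hγ he.symm (hlast.trans_lt hlt) ?_
    have h3 := closedRegion_le_pow hγ M 2 (by omega)
    have e : (⟨2 + M, by omega⟩ : Fin (M + 4)) = (Fin.last (M + 2)).castSucc := by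
      ext; simp; omega
    rw [e] at h3
    have h4 : γ ⟨2, by omega⟩ = γ 2 := rfl
    rw [h4] at h3
    by_contra hn
    nlinarith [show (0 : ℝ) < 2 ^ M by positivity, Real.exp_pos (-4)]
  have hmem : γ ∈ rmaRegion (M + 3) (γ (Fin.last _)) := ⟨hγ0, rfl, hγ.2⟩
  have hlR : γ (Fin.last _) = R := by
    refine le_antisymm hlast (not_lt.1 fun hn => hF.not_gt ?_)
    rw [← rmaExponent_eq hγ]
    exact rmaExponent_neg (last_pos hγ hγ0) hn hmem
  rw [hlR] at hmem
  exact ⟨γ, hmem, le_antisymm (rmaExponent_nonpos hmem) (by rwa [rmaExponent_eq hγ])⟩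

/-- A maximum over the closure is attained by compactness, and the added vectors, of input weight
zero, have nonpositive exponent. -/
theorem exists_isMaxOn {q M : ℕ} (hM : 1 ≤ M) {ρ : ℝ}
    (h : ∃ γ ∈ rmaRegion M ρ, 0 ≤ rmaExponent q M γ) :
    ∃ γ ∈ rmaRegion M ρ, IsMaxOn (rmaExponent q M) (rmaRegion M ρ) γ := by
  obtain ⟨γ₀, hγ₀, hf₀⟩ := h
  have hK : IsCompact (closedRegion M ∩ {γ | γ (Fin.last M) = ρ}) :=
    (isCompact_closedRegion hM).inter_right (isClosed_eq (by fun_prop) continuous_const)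
  obtain ⟨γ, hγ, hmax⟩ := hK.exists_isMaxOn ⟨γ₀, rmaRegion_subset hγ₀, hγ₀.2.1⟩
    (continuous_chainExponent q M).continuousOn
  have hle : ∀ γ' ∈ rmaRegion M ρ, rmaExponent q M γ' ≤ chainExponent q M γ := by
    intro γ' h'
    rw [rmaExponent_eq (rmaRegion_subset h')]
    exact hmax ⟨rmaRegion_subset h', h'.2.1⟩
  rcases hγ.1.1.eq_or_lt with h0 | h0
  · have := chainExponent_nonpos_of_zero (q := q) hγ.1 h0.symm
    exact ⟨γ₀, hγ₀, fun γ' h' => ((hle γ' h').trans this).trans hf₀⟩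
  · refine ⟨γ, ⟨h0, hγ.2, hγ.1.2⟩, fun γ' h' => ?_⟩
    change rmaExponent q M γ' ≤ rmaExponent q M γ
    rw [rmaExponent_eq hγ.1]
    exact hle γ' h'

/-- A value of the form taken by the recursion of `SolvesRmaSystem` is a possible output weight. -/
lemma recursion_bounds {a y : ℝ} (ha : a ≤ 1 / 2) (hy : 0 < y) :
    a / 2 < 1 / 2 - (1 - a) / 2 * Real.sqrt (1 - y) ∧
      1 / 2 - (1 - a) / 2 * Real.sqrt (1 - y) ≤ 1 / 2 := by
  have h0 := Real.sqrt_nonneg (1 - y)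
  have h1 : Real.sqrt (1 - y) < 1 := by
    rw [Real.sqrt_lt' one_pos]; linarith
  constructor <;> nlinarith

theorem mem_rmaRegion_of_solves {q M : ℕ} {γ : Fin (M + 1) → ℝ} (h : SolvesRmaSystem q M γ) :
    γ ∈ rmaRegion M (γ (Fin.last M)) := by
  obtain ⟨h0, hh, h1, h2⟩ := h
  have key : ∀ (n : ℕ) (hn : n + 1 < M + 1), (0 < γ ⟨n, by omega⟩ ∧ γ ⟨n, by omega⟩ ≤ 1 / 2) ∧
      γ ⟨n, by omega⟩ / 2 < γ ⟨n + 1, hn⟩ ∧ γ ⟨n + 1, hn⟩ ≤ 1 / 2 := by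
    intro n
    induction n with
    | zero =>
      intro hn
      refine ⟨⟨h0, hh⟩, ?_⟩
      have e := h1 hn
      have := recursion_bounds hh (Real.rpow_pos_of_pos (div_pos h0 (by linarith : 0 < 1 - γ 0))
        ((2 : ℝ) / q))
      rw [← e] at this
      exact this
    | succ n ih =>
      intro hn
      obtain ⟨⟨a0, a1⟩, b0, b1⟩ := ih (by omega)
      refine ⟨⟨by linarith, b1⟩, ?_⟩
      rw [h2 n (by omega) (by omega) hn]
      refine recursion_bounds b1 (pow_pos (mul_pos (div_pos ?_ ?_) (div_pos ?_ ?_)) 2) <;> linarith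
  refine ⟨h0, rfl, fun ℓ => step_iff.2 ?_⟩
  obtain ⟨⟨a0, a1⟩, b0, b1⟩ := key ℓ (by omega)
  have e1 : γ ℓ.castSucc = γ ⟨ℓ, by omega⟩ := rfl
  have e2 : γ ℓ.succ = γ ⟨ℓ + 1, by omega⟩ := rfl
  rw [e1, e2]
  constructor <;> linarith

/-! ### Maximizers of the exponent are interior -/

/-- The entropy of two masses `u`, `v`, homogeneous of degree one: `(u + v) H (u / (u + v))`. -/
noncomputable def massEntropy (u v : ℝ) : ℝ :=
  Real.negMulLog u + Real.negMulLog v - Real.negMulLog (u + v)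

lemma stepExponent_eq_massEntropy (a b : ℝ) : stepExponent a b =
    massEntropy (b - a / 2) (1 - b - a / 2) - Real.binEntropy b + a * Real.log 2 := by
  unfold stepExponent massEntropy
  rw [show b - a / 2 + (1 - b - a / 2) = 1 - a by ring]

lemma binEntropy_eq_massEntropy (a : ℝ) : Real.binEntropy a = massEntropy a (1 - a) := by
  rw [Real.binEntropy_eq_negMulLog_add_negMulLog_one_sub, massEntropy]
  simp

lemma massEntropy_comm (u v : ℝ) : massEntropy u v = massEntropy v u := by
  unfold massEntropy
  rw [add_comm u v, add_comm (Real.negMulLog u)]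

lemma massEntropy_eq {u v : ℝ} (hu : 0 < u) (hv : 0 < v) : massEntropy u v =
    - u * Real.log (u / (u + v)) - v * Real.log (1 - u / (u + v)) := by
  have e : 1 - u / (u + v) = v / (u + v) := by field_simp; ring
  rw [e, Real.log_div hu.ne' (by positivity), Real.log_div hv.ne' (by positivity), massEntropy]
  unfold Real.negMulLog
  ring

lemma massEntropy_zero (v : ℝ) : massEntropy 0 v = 0 := by simp [massEntropy]

/-- Along a segment that starts on the boundary `u = 0` the entropy has infinite slope. -/
lemma massEntropy_slope_zero {v₀ u₁ v₁ : ℝ} (hv₀ : 0 < v₀) (hu₁ : 0 < u₁)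
    (hv₁ : 0 < v₁) {t : ℝ} (ht : 0 < t) (ht1 : t < 1) :
    u₁ * (t * -Real.log t) - u₁ * Real.log (u₁ / min v₀ v₁) * t
      ≤ massEntropy (t * u₁) ((1 - t) * v₀ + t * v₁) := by
  have hc : 0 < min v₀ v₁ := lt_min hv₀ hv₁
  have hv : min v₀ v₁ ≤ (1 - t) * v₀ + t * v₁ := by
    nlinarith [min_le_left v₀ v₁, min_le_right v₀ v₁]
  have hu : 0 < t * u₁ := by positivity
  have hvp : 0 < (1 - t) * v₀ + t * v₁ := hc.trans_le hv
  rw [massEntropy_eq hu hvp]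
  have h1 : Real.log (1 - t * u₁ / (t * u₁ + ((1 - t) * v₀ + t * v₁))) ≤ 0 := by
    refine Real.log_nonpos ?_ ?_
    · rw [sub_nonneg, div_le_one (by positivity)]; linarith
    · have := div_pos hu (add_pos hu hvp); linarith
  have h2 : Real.log (t * u₁ / (t * u₁ + ((1 - t) * v₀ + t * v₁)))
      ≤ Real.log (t * (u₁ / min v₀ v₁)) := by
    refine Real.log_le_log (by positivity) ?_
    rw [← mul_div_assoc]
    exact div_le_div_of_nonneg_left hu.le hc (by linarith)
  rw [Real.log_mul ht.ne' (by positivity)] at h2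
  nlinarith [mul_le_mul_of_nonneg_left h2 hu.le, mul_nonneg hvp.le (neg_nonneg.2 h1)]

lemma massEntropy_concave {u₀ v₀ u₁ v₁ : ℝ} (hu₀ : 0 ≤ u₀) (hv₀ : 0 ≤ v₀) (hu₁ : 0 < u₁)
    (hv₁ : 0 < v₁) {t : ℝ} (ht : 0 < t) (ht1 : t < 1) :
    (1 - t) * massEntropy u₀ v₀ + t * massEntropy u₁ v₁
      ≤ massEntropy ((1 - t) * u₀ + t * u₁) ((1 - t) * v₀ + t * v₁) := by
  have h1t : 0 < 1 - t := by linarith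
  have hu : 0 < (1 - t) * u₀ + t * u₁ := by positivity
  have hv : 0 < (1 - t) * v₀ + t * v₁ := by positivity
  rw [massEntropy_eq hu hv]
  set p := ((1 - t) * u₀ + t * u₁) / ((1 - t) * u₀ + t * u₁ + ((1 - t) * v₀ + t * v₁))
  have hp : 0 < p := by positivity
  have hp1 : p < 1 := by
    rw [div_lt_one (by positivity)]; linarith
  have k0 := mul_le_mul_of_nonneg_left (gibbs hu₀ hv₀ hp hp1) h1t.le
  have k1 := mul_le_mul_of_nonneg_left (gibbs hu₁.le hv₁.le hp hp1) ht.le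
  unfold massEntropy
  linarith

/-- A lower bound for the growth of the entropy along a segment into the interior. The coefficient
`κ` of the term of infinite slope is positive if the segment starts on the boundary, away from the
origin. -/
lemma massEntropy_slope {u₀ v₀ u₁ v₁ : ℝ} (hu₀ : 0 ≤ u₀) (hv₀ : 0 ≤ v₀) (hu₁ : 0 < u₁)
    (hv₁ : 0 < v₁) : ∃ κ C : ℝ, 0 ≤ κ ∧ (0 < u₀ + v₀ → u₀ = 0 ∨ v₀ = 0 → 0 < κ) ∧
      ∀ t : ℝ, 0 < t → t < 1 → massEntropy u₀ v₀ + κ * (t * -Real.log t) - C * t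
        ≤ massEntropy ((1 - t) * u₀ + t * u₁) ((1 - t) * v₀ + t * v₁) := by
  by_cases h : 0 < u₀ + v₀ ∧ (u₀ = 0 ∨ v₀ = 0)
  · obtain ⟨hs, rfl | rfl⟩ := h
    · refine ⟨u₁, u₁ * Real.log (u₁ / min v₀ v₁), hu₁.le, fun _ _ => hu₁, fun t h0 h1 => ?_⟩
      have := massEntropy_slope_zero (by simpa using hs) hu₁ hv₁ h0 h1
      rw [massEntropy_zero, zero_add, mul_zero, zero_add]
      exact this
    · refine ⟨v₁, v₁ * Real.log (v₁ / min u₀ u₁), hv₁.le, fun _ _ => hv₁, fun t h0 h1 => ?_⟩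
      have := massEntropy_slope_zero (by simpa using hs) hv₁ hu₁ h0 h1
      rw [massEntropy_comm, massEntropy_zero, zero_add, massEntropy_comm, mul_zero, zero_add]
      exact this
  · refine ⟨0, massEntropy u₀ v₀ - massEntropy u₁ v₁, le_rfl, fun h1 h2 => absurd ⟨h1, h2⟩ h,
      fun t h0 h1 => ?_⟩
    have := massEntropy_concave hu₀ hv₀ hu₁ hv₁ h0 h1
    linarith

lemma stepExponent_slope {a b a₁ b₁ : ℝ} (hb0 : 0 < b) (hb1 : b < 1)
    (h : a ≤ 2 * min b (1 - b)) (h₁0 : 0 ≤ a₁) (h₁ : a₁ < 2 * b₁) (h₁' : a₁ < 2 * (1 - b₁)) :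
    ∃ κ C : ℝ, 0 ≤ κ ∧ (a < 1 → a = 2 * b ∨ a = 2 * (1 - b) → 0 < κ) ∧
      ∀ t : ℝ, 0 < t → t < 1 → stepExponent a b + κ * (t * -Real.log t) - C * t
        ≤ stepExponent ((1 - t) * a + t * a₁) ((1 - t) * b + t * b₁) := by
  obtain ⟨h1, h2⟩ := step_iff.1 h
  obtain ⟨κ, C, hκ, hpos, hb⟩ := massEntropy_slope (u₀ := b - a / 2) (v₀ := 1 - b - a / 2)
    (u₁ := b₁ - a₁ / 2) (v₁ := 1 - b₁ - a₁ / 2) (by linarith) (by linarith) (by linarith)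
    (by linarith)
  refine ⟨κ, C + (b - b₁) * (Real.log b - Real.log (1 - b)) + (a - a₁) * Real.log 2, hκ,
    fun ha hor => hpos (by linarith) (hor.imp (by intro; linarith) (by intro; linarith)),
    fun t h0 ht1 => ?_⟩
  have hM := hb t h0 ht1
  rw [stepExponent_eq_massEntropy, stepExponent_eq_massEntropy]
  set b' := (1 - t) * b + t * b₁ with hb'
  have e1 : (1 - t) * (b - a / 2) + t * (b₁ - a₁ / 2) = b' - ((1 - t) * a + t * a₁) / 2 := by
    rw [hb']; ring
  have e2 : (1 - t) * (1 - b - a / 2) + t * (1 - b₁ - a₁ / 2)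
      = 1 - b' - ((1 - t) * a + t * a₁) / 2 := by
    rw [hb']; ring
  rw [e1, e2] at hM
  have h1t : 0 < 1 - t := by linarith
  have hb1p : 0 < b₁ := by linarith
  have hb1q : 0 < 1 - b₁ := by linarith
  have hb'0 : 0 ≤ b' := by positivity
  have hb'1 : 0 ≤ 1 - b' := by
    rw [show 1 - b' = (1 - t) * (1 - b) + t * (1 - b₁) by rw [hb']; ring]
    have : 0 < 1 - b := by linarith
    positivity
  -- the output entropy enters with a negative sign, and stays below its tangent at `b`
  have k := gibbs hb'0 hb'1 hb0 hb1
  rw [show b' + (1 - b') = 1 by ring, Real.negMulLog_one, sub_zero,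
    ← Real.binEntropy_eq_negMulLog_add_negMulLog_one_sub] at k
  have hH : Real.binEntropy b = - b * Real.log b - (1 - b) * Real.log (1 - b) := by
    rw [Real.binEntropy_eq_negMulLog_add_negMulLog_one_sub]; unfold Real.negMulLog; ring
  rw [hH]
  have e3 : - b' * Real.log b - (1 - b') * Real.log (1 - b) =
      - b * Real.log b - (1 - b) * Real.log (1 - b)
        + (b - b₁) * (Real.log b - Real.log (1 - b)) * t := by
    rw [hb']; ring
  rw [e3] at k
  nlinarith

lemma nonpos_of_mul_neg_log_le {κ C : ℝ}
    (h : ∀ t : ℝ, 0 < t → t < 1 → κ * (t * -Real.log t) ≤ C * t) : κ ≤ 0 := by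
  by_contra hn
  push Not at hn
  set s := (|C| + 1) / κ
  have hs : 0 < s := by positivity
  have := h (Real.exp (-s)) (Real.exp_pos _) (by rw [Real.exp_lt_one_iff]; linarith)
  rw [Real.log_exp] at this
  have h2 : κ * s ≤ C := by
    have hp := Real.exp_pos (-s)
    by_contra hc
    nlinarith [mul_pos (sub_pos.2 (not_le.1 hc)) hp]
  have h3 : κ * s = |C| + 1 := by simp only [s]; field_simp
  linarith [le_abs_self C]

section Maximizer

variable {q M : ℕ} {ρ : ℝ} {γ : Fin (M + 1) → ℝ}

lemma region_pos (h : γ ∈ rmaRegion M ρ) (i : Fin (M + 1)) : 0 < γ i := by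
  induction i using Fin.induction with
  | zero => exact h.1
  | succ i ih => linarith [(step_iff.1 (h.2.2 i)).1]

lemma region_succ_lt_one (h : γ ∈ rmaRegion M ρ) (i : Fin M) : γ i.succ < 1 := by
  linarith [(step_iff.1 (h.2.2 i)).2, region_pos h i.castSucc]

/-- A maximizer of the exponent lies in the interior: on the segment to the vector with all weights
equal to `ρ` the exponent would otherwise start with infinite slope. -/
theorem interior_of_isMaxOn (hq : 0 < q) (hM : 1 ≤ M) (hρ : 0 < ρ) (hρ' : ρ ≤ 1 / 2)
    (h : γ ∈ rmaRegion M ρ) (hmax : IsMaxOn (rmaExponent q M) (rmaRegion M ρ) γ) :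
    (∀ i, γ i < 1) ∧ ∀ ℓ : Fin M, γ ℓ.castSucc < 2 * γ ℓ.succ ∧
      γ ℓ.castSucc < 2 * (1 - γ ℓ.succ) := by
  have hc := rmaRegion_subset h
  obtain ⟨κ₀, C₀, hκ₀, hpos₀, hs₀⟩ := massEntropy_slope (u₀ := γ 0) (v₀ := 1 - γ 0)
    (u₁ := ρ) (v₁ := 1 - ρ) h.1.le (by linarith [closedRegion_le_one hM hc 0]) hρ (by linarith)
  have hstep := fun ℓ : Fin M => stepExponent_slope (a₁ := ρ) (b₁ := ρ)
    (region_pos h ℓ.succ) (region_succ_lt_one h ℓ) (h.2.2 ℓ) hρ.le (by linarith) (by linarith)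
  choose κ C hκ hpos hs using hstep
  have hsum : κ₀ / q + ∑ ℓ, κ ℓ ≤ 0 := by
    refine nonpos_of_mul_neg_log_le (C := C₀ / q + ∑ ℓ, C ℓ) fun t h0 h1 => ?_
    have hγt : (fun i => (1 - t) * γ i + t * ρ) ∈ rmaRegion M ρ := by
      have h1t : 0 < 1 - t := by linarith
      refine ⟨add_pos (mul_pos h1t h.1) (mul_pos h0 hρ), by simp only [h.2.1]; ring,
        fun ℓ => step_iff.2 ?_⟩
      obtain ⟨s1, s2⟩ := step_iff.1 (h.2.2 ℓ)
      constructor <;> nlinarith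
    have hle : rmaExponent q M (fun i => (1 - t) * γ i + t * ρ) ≤ rmaExponent q M γ := hmax hγt
    rw [rmaExponent_eq hc, rmaExponent_eq (rmaRegion_subset hγt)] at hle
    unfold chainExponent at hle
    have k0 := div_le_div_of_nonneg_right (hs₀ t h0 h1) (show (0 : ℝ) ≤ q by positivity)
    rw [show (1 - t) * (1 - γ 0) + t * (1 - ρ) = 1 - ((1 - t) * γ 0 + t * ρ) by ring,
      ← binEntropy_eq_massEntropy, ← binEntropy_eq_massEntropy] at k0
    have k1 := Finset.sum_le_sum fun ℓ (_ : ℓ ∈ Finset.univ) => hs ℓ t h0 h1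
    rw [Finset.sum_sub_distrib, Finset.sum_add_distrib, ← Finset.sum_mul, ← Finset.sum_mul] at k1
    rw [sub_div, add_div, mul_div_right_comm, mul_div_right_comm] at k0
    linarith
  have hq' : (0 : ℝ) < q := by exact_mod_cast hq
  have hκsum : 0 ≤ ∑ ℓ, κ ℓ := Finset.sum_nonneg fun ℓ _ => hκ ℓ
  have hlt : ∀ i, γ i < 1 := by
    intro i
    induction i using Fin.cases with
    | zero =>
      refine lt_of_le_of_ne (closedRegion_le_one hM hc 0) fun he => ?_
      have := div_pos (hpos₀ (by linarith) (Or.inr (by linarith))) hq'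
      linarith
    | succ i => exact region_succ_lt_one h i
  have hne : ∀ ℓ : Fin M, ¬ (γ ℓ.castSucc = 2 * γ ℓ.succ ∨ γ ℓ.castSucc = 2 * (1 - γ ℓ.succ)) := by
    intro ℓ hor
    have h1 := hpos ℓ (hlt _) hor
    have h2 := Finset.single_le_sum (f := κ) (fun ℓ _ => hκ ℓ) (Finset.mem_univ ℓ)
    have := div_nonneg hκ₀ hq'.le
    linarith
  refine ⟨hlt, fun ℓ => ?_⟩
  obtain ⟨s1, s2⟩ := step_iff.1 (h.2.2 ℓ)
  have hn := not_or.1 (hne ℓ)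
  exact ⟨lt_of_le_of_ne s1 hn.1, lt_of_le_of_ne s2 hn.2⟩

end Maximizer

/-! ### The stationary-point equations -/

/-- The partial derivative of `stepExponent` with respect to the input weight. -/
noncomputable def stepDerivIn (a b : ℝ) : ℝ :=
  Real.log (b - a / 2) / 2 + Real.log (1 - b - a / 2) / 2 - Real.log (1 - a) + Real.log 2

/-- The partial derivative of `stepExponent` with respect to the output weight. -/
noncomputable def stepDerivOut (a b : ℝ) : ℝ :=
  Real.log (1 - b - a / 2) - Real.log (b - a / 2) - Real.log (1 - b) + Real.log b

lemma hasDerivAt_stepExponent {a b x y : ℝ} (ha : a < 1) (hb0 : b ≠ 0) (hb1 : b ≠ 1)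
    (hu : a < 2 * b) (hv : a < 2 * (1 - b)) :
    HasDerivAt (fun t : ℝ => stepExponent (a + t * x) (b + t * y))
      (stepDerivIn a b * x + stepDerivOut a b * y) 0 := by
  have lin : ∀ c d : ℝ, HasDerivAt (fun t : ℝ => c + t * d) d 0 := fun c d => by
    simpa using ((hasDerivAt_id (0 : ℝ)).mul_const d).const_add c
  have comp : ∀ (g : ℝ → ℝ) (g' c d : ℝ), HasDerivAt g g' c →
      HasDerivAt (fun t : ℝ => g (c + t * d)) (g' * d) 0 := fun g g' c d hg => by
    have hg' : HasDerivAt g g' (c + 0 * d) := by simpa using hg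
    exact hg'.comp (0 : ℝ) (lin c d)
  have d1 := comp _ _ _ (y - x / 2)
    (Real.hasDerivAt_negMulLog (x := b - a / 2) (by intro h; linarith))
  have d2 := comp _ _ _ (-y - x / 2)
    (Real.hasDerivAt_negMulLog (x := 1 - b - a / 2) (by intro h; linarith))
  have d3 := comp _ _ _ (-x) (Real.hasDerivAt_negMulLog (x := 1 - a) (by intro h; linarith))
  have d4 := comp _ _ _ y (Real.hasDerivAt_binEntropy hb0 hb1)
  have d5 := (lin a x).mul_const (Real.log 2)
  have d := (((d1.add d2).sub d3).sub d4).add d5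
  refine (d.congr_deriv ?_).congr_of_eventuallyEq (Eventually.of_forall fun t => ?_)
  · unfold stepDerivIn stepDerivOut
    ring
  · simp only [Pi.add_apply, Pi.sub_apply]
    unfold stepExponent
    ring_nf

section Stationary

variable {q M : ℕ} {ρ : ℝ} {γ : Fin (M + 1) → ℝ}

lemma directional_deriv_eq_zero (hq : 0 < q) (hM : 1 ≤ M) (hρ : 0 < ρ) (hρ' : ρ ≤ 1 / 2)
    (h : γ ∈ rmaRegion M ρ) (hmax : IsMaxOn (rmaExponent q M) (rmaRegion M ρ) γ)
    {v : Fin (M + 1) → ℝ} (hv : v (Fin.last M) = 0) :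
    (Real.log (1 - γ 0) - Real.log (γ 0)) * v 0 / q +
      ∑ ℓ : Fin M, (stepDerivIn (γ ℓ.castSucc) (γ ℓ.succ) * v ℓ.castSucc
        + stepDerivOut (γ ℓ.castSucc) (γ ℓ.succ) * v ℓ.succ) = 0 := by
  obtain ⟨hlt, hint⟩ := interior_of_isMaxOn hq hM hρ hρ' h hmax
  have hpos := region_pos h
  have hd : HasDerivAt (fun t : ℝ => chainExponent q M (fun i => γ i + t * v i))
      ((Real.log (1 - γ 0) - Real.log (γ 0)) * v 0 / q +
      ∑ ℓ : Fin M, (stepDerivIn (γ ℓ.castSucc) (γ ℓ.succ) * v ℓ.castSucc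
        + stepDerivOut (γ ℓ.castSucc) (γ ℓ.succ) * v ℓ.succ)) 0 := by
    unfold chainExponent
    refine HasDerivAt.add (HasDerivAt.div_const ?_ _) (HasDerivAt.fun_sum fun ℓ _ =>
      hasDerivAt_stepExponent (hlt _) (hpos _).ne' (hlt _).ne (hint ℓ).1 (hint ℓ).2)
    have lin : HasDerivAt (fun t : ℝ => γ 0 + t * v 0) (v 0) 0 := by
      simpa using ((hasDerivAt_id (0 : ℝ)).mul_const (v 0)).const_add (γ 0)
    have hg : HasDerivAt Real.binEntropy (Real.log (1 - γ 0) - Real.log (γ 0)) (γ 0 + 0 * v 0) := by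
      simpa using Real.hasDerivAt_binEntropy (hpos 0).ne' (hlt 0).ne
    exact hg.comp (0 : ℝ) lin
  refine IsLocalMax.hasDerivAt_eq_zero ?_ hd
  have hmem : ∀ᶠ t : ℝ in 𝓝 0, (fun i => γ i + t * v i) ∈ rmaRegion M ρ := by
    have c : ∀ i, ContinuousAt (fun t : ℝ => γ i + t * v i) 0 := fun i => by fun_prop
    have e0 : ∀ᶠ t : ℝ in 𝓝 0, 0 < γ 0 + t * v 0 :=
      (c 0).eventually (lt_mem_nhds (by simpa using hpos 0))
    have e1 : ∀ ℓ : Fin M, ∀ᶠ t : ℝ in 𝓝 0,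
        γ ℓ.castSucc + t * v ℓ.castSucc ≤ 2 * min (γ ℓ.succ + t * v ℓ.succ)
          (1 - (γ ℓ.succ + t * v ℓ.succ)) := by
      intro ℓ
      have c1 : ContinuousAt (fun t : ℝ => 2 * (γ ℓ.succ + t * v ℓ.succ)
        - (γ ℓ.castSucc + t * v ℓ.castSucc)) 0 := by fun_prop
      have c2 : ContinuousAt (fun t : ℝ => 2 * (1 - (γ ℓ.succ + t * v ℓ.succ))
        - (γ ℓ.castSucc + t * v ℓ.castSucc)) 0 := by fun_prop
      filter_upwards [c1.eventually (lt_mem_nhds (a := 0) (by simpa using (hint ℓ).1)),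
        c2.eventually (lt_mem_nhds (a := 0) (by simpa using (hint ℓ).2))] with t h1 h2
      exact step_iff.2 ⟨by linarith, by linarith⟩
    filter_upwards [e0, eventually_all.2 e1] with t h1 h2
    exact ⟨h1, by simp [hv, h.2.1], h2⟩
  filter_upwards [hmem] with t ht
  have hle : rmaExponent q M (fun i => γ i + t * v i) ≤ rmaExponent q M γ := hmax ht
  rw [rmaExponent_eq (rmaRegion_subset h), rmaExponent_eq (rmaRegion_subset ht)] at hle
  simpa using hle

lemma stationary_zero (hq : 0 < q) (hM : 1 ≤ M) (hρ : 0 < ρ) (hρ' : ρ ≤ 1 / 2)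
    (h : γ ∈ rmaRegion M ρ) (hmax : IsMaxOn (rmaExponent q M) (rmaRegion M ρ) γ) :
    (Real.log (1 - γ 0) - Real.log (γ 0)) / q + stepDerivIn (γ 0) (γ ⟨1, by omega⟩) = 0 := by
  have hk : (⟨0, hM⟩ : Fin M).castSucc = 0 := rfl
  have hv : (Pi.single 0 1 : Fin (M + 1) → ℝ) (Fin.last M) = 0 :=
    Pi.single_eq_of_ne (by intro he; rw [Fin.ext_iff] at he; simp at he; omega) _
  have := directional_deriv_eq_zero hq hM hρ hρ' h hmax hv
  rw [Finset.sum_eq_single ⟨0, hM⟩] at this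
  · rw [hk] at this
    have hs : (⟨0, hM⟩ : Fin M).succ = ⟨1, by omega⟩ := rfl
    rw [hs, Pi.single_eq_same, Pi.single_eq_of_ne (by simp [Fin.ext_iff]), mul_one] at this
    simpa using this
  · intro ℓ _ hne
    rw [Pi.single_eq_of_ne (fun he => hne (Fin.castSucc_injective M (he.trans hk.symm))),
      Pi.single_eq_of_ne (by simp)]
    ring
  · simp

lemma stationary_succ (hq : 0 < q) (hρ : 0 < ρ) (hρ' : ρ ≤ 1 / 2)
    (h : γ ∈ rmaRegion M ρ) (hmax : IsMaxOn (rmaExponent q M) (rmaRegion M ρ) γ)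
    (n : ℕ) (hn : n + 1 < M) :
    stepDerivOut (γ ⟨n, by omega⟩) (γ ⟨n + 1, by omega⟩)
      + stepDerivIn (γ ⟨n + 1, by omega⟩) (γ ⟨n + 2, by omega⟩) = 0 := by
  set i : Fin (M + 1) := ⟨n + 1, by omega⟩ with hi
  have hv : (Pi.single i 1 : Fin (M + 1) → ℝ) (Fin.last M) = 0 :=
    Pi.single_eq_of_ne (by intro he; rw [Fin.ext_iff] at he; simp [hi] at he; omega) _
  have := directional_deriv_eq_zero hq (by omega) hρ hρ' h hmax hv
  rw [Finset.sum_add_distrib, Finset.sum_eq_single ⟨n + 1, hn⟩,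
    Finset.sum_eq_single ⟨n, by omega⟩] at this
  · have e1 : (⟨n + 1, hn⟩ : Fin M).castSucc = i := rfl
    have e2 : (⟨n, by omega⟩ : Fin M).succ = i := rfl
    have e3 : (⟨n + 1, hn⟩ : Fin M).succ = ⟨n + 2, by omega⟩ := rfl
    have e4 : (⟨n, by omega⟩ : Fin M).castSucc = ⟨n, by omega⟩ := rfl
    rw [e1, e2, e3, e4, Pi.single_eq_same, Pi.single_eq_of_ne (by simp [hi, Fin.ext_iff]), mul_zero,
      zero_div] at this
    linarith
  · intro ℓ _ hne
    rw [Pi.single_eq_of_ne, mul_zero]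
    intro he
    exact hne (by rw [Fin.ext_iff] at he ⊢; simpa [hi] using he)
  · simp
  · intro ℓ _ hne
    rw [Pi.single_eq_of_ne, mul_zero]
    intro he
    exact hne (by rw [Fin.ext_iff] at he ⊢; simpa [hi] using he)
  · simp

/-- A vanishing derivative, solved for the output weight `c ≤ 1 / 2`. -/
lemma solve_stationary {a c y : ℝ} (ha : a < 1) (hu : a < 2 * c) (hv : a < 2 * (1 - c))
    (hy : 0 < y) (h : 2 * stepDerivIn a c = Real.log y) :
    y ≤ 1 ∧ (c ≤ 1 / 2 → c = 1 / 2 - (1 - a) / 2 * Real.sqrt (1 - y)) := by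
  have hu' : 0 < c - a / 2 := by linarith
  have hv' : 0 < 1 - c - a / 2 := by linarith
  have ha' : 0 < 1 - a := by linarith
  have e : 2 * stepDerivIn a c
      = Real.log (4 * ((c - a / 2) * (1 - c - a / 2)) / (1 - a) ^ 2) := by
    rw [Real.log_div (by positivity) (by positivity), Real.log_mul (by norm_num) (by positivity),
      Real.log_mul hu'.ne' hv'.ne', Real.log_pow, show (4 : ℝ) = 2 ^ 2 by norm_num, Real.log_pow]
    unfold stepDerivIn
    push_cast
    ring
  rw [e] at h
  have hxy := Real.log_injOn_pos (Set.mem_Ioi.2 (by positivity)) (Set.mem_Ioi.2 hy) h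
  rw [div_eq_iff (by positivity)] at hxy
  have hsq : (1 - 2 * c) ^ 2 = (1 - a) ^ 2 * (1 - y) := by nlinarith
  have hy1 : y ≤ 1 := by
    by_contra hn
    nlinarith [sq_nonneg (1 - 2 * c), pow_pos ha' 2]
  refine ⟨hy1, fun hc => ?_⟩
  have : 1 - 2 * c = (1 - a) * Real.sqrt (1 - y) := by
    rw [← Real.sqrt_sq (show 0 ≤ 1 - 2 * c by linarith), hsq, Real.sqrt_mul (by positivity),
      Real.sqrt_sq ha'.le]
  linarith

/-- The derivatives with respect to all weights but the last vanish at an interior maximizer. Each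
of these equations bounds one of the weights by `1 / 2`, which selects the branch of the square root
for the preceding equation. -/
theorem solves_of_isMaxOn (hq : 0 < q) (hM : 1 ≤ M) (hρ : 0 < ρ) (hρ' : ρ ≤ 1 / 2)
    (h : γ ∈ rmaRegion M ρ) (hmax : IsMaxOn (rmaExponent q M) (rmaRegion M ρ) γ) :
    SolvesRmaSystem q M γ := by
  obtain ⟨hlt, hint⟩ := interior_of_isMaxOn hq hM hρ hρ' h hmax
  have hpos := region_pos h
  have hq' : (0 : ℝ) < q := by exact_mod_cast hq
  have ha0 := hpos 0
  have ha1 : 0 < 1 - γ 0 := by linarith [hlt 0]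
  have key0 := solve_stationary (y := (γ 0 / (1 - γ 0)) ^ ((2 : ℝ) / q)) (hlt 0)
    (hint ⟨0, hM⟩).1 (hint ⟨0, hM⟩).2 (by positivity) (by
      have := stationary_zero hq hM hρ hρ' h hmax
      have es : (⟨0, hM⟩ : Fin M).succ = ⟨1, by omega⟩ := rfl
      rw [es, Real.log_rpow (by positivity), Real.log_div ha0.ne' ha1.ne']
      have e2 : (2 : ℝ) / q * (Real.log (γ 0) - Real.log (1 - γ 0)) =
        - 2 * ((Real.log (1 - γ 0) - Real.log (γ 0)) / q) := by ring
      rw [e2]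
      linarith)
  have keyS : ∀ (n : ℕ) (hn : n + 1 < M), _ := fun n hn =>
    solve_stationary (a := γ ⟨n + 1, by omega⟩) (c := γ ⟨n + 2, by omega⟩)
      (y := ((1 - γ ⟨n + 1, by omega⟩) / γ ⟨n + 1, by omega⟩ *
        ((γ ⟨n + 1, by omega⟩ - γ ⟨n, by omega⟩ / 2) /
          (1 - γ ⟨n + 1, by omega⟩ - γ ⟨n, by omega⟩ / 2))) ^ 2) (hlt _)
      (hint ⟨n + 1, hn⟩).1 (hint ⟨n + 1, hn⟩).2 (by
        have h1 := (hint ⟨n, by omega⟩).1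
        have h2 := (hint ⟨n, by omega⟩).2
        have e1 : (⟨n, by omega⟩ : Fin M).succ = ⟨n + 1, by omega⟩ := rfl
        have e2 : (⟨n, by omega⟩ : Fin M).castSucc = ⟨n, by omega⟩ := rfl
        rw [e1, e2] at h1 h2
        have := hlt ⟨n + 1, by omega⟩
        refine pow_pos (mul_pos (div_pos ?_ (hpos _)) (div_pos ?_ ?_)) 2 <;> linarith) (by
        have h1 := (hint ⟨n, by omega⟩).1
        have h2 := (hint ⟨n, by omega⟩).2
        have e1 : (⟨n, by omega⟩ : Fin M).succ = ⟨n + 1, by omega⟩ := rfl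
        have e2 : (⟨n, by omega⟩ : Fin M).castSucc = ⟨n, by omega⟩ := rfl
        rw [e1, e2] at h1 h2
        have h3 := hlt ⟨n + 1, by omega⟩
        have h4 := hpos ⟨n + 1, by omega⟩
        have st := stationary_succ hq hρ hρ' h hmax n hn
        have w1 : 1 - γ ⟨n + 1, by omega⟩ ≠ 0 := by intro; linarith
        have w2 : γ ⟨n + 1, by omega⟩ - γ ⟨n, by omega⟩ / 2 ≠ 0 := by intro; linarith
        have w3 : 1 - γ ⟨n + 1, by omega⟩ - γ ⟨n, by omega⟩ / 2 ≠ 0 := by intro; linarith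
        rw [Real.log_pow, Real.log_mul (div_ne_zero w1 h4.ne') (div_ne_zero w2 w3),
          Real.log_div w1 h4.ne', Real.log_div w2 w3]
        unfold stepDerivOut at st
        push_cast
        linarith)
  have hα : γ 0 ≤ 1 / 2 := by
    by_contra hn
    have : 1 < γ 0 / (1 - γ 0) := by rw [one_lt_div ha1]; linarith
    exact absurd (Real.one_lt_rpow this (by positivity)) key0.1.not_gt
  have hhalf : ∀ (n : ℕ) (hn : n + 1 < M + 1), γ ⟨n + 1, hn⟩ ≤ 1 / 2 := by
    intro n hn
    rcases (show n + 1 ≤ M by omega).eq_or_lt with he | hn'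
    · have : (⟨n + 1, hn⟩ : Fin (M + 1)) = Fin.last M := by ext; simpa using he
      rw [this, h.2.1]
      exact hρ'
    · have hy := (keyS n hn').1
      have h1 := (hint ⟨n, by omega⟩).1
      have h2 := (hint ⟨n, by omega⟩).2
      have e1 : (⟨n, by omega⟩ : Fin M).succ = ⟨n + 1, hn⟩ := rfl
      have e2 : (⟨n, by omega⟩ : Fin M).castSucc = ⟨n, by omega⟩ := rfl
      rw [e1, e2] at h1 h2
      have h3 := hlt ⟨n + 1, hn⟩
      have h4 := hpos ⟨n + 1, hn⟩
      have h5 := hpos ⟨n, by omega⟩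
      set b := γ ⟨n + 1, hn⟩
      set a := γ ⟨n, by omega⟩
      have w3 : 0 < 1 - b - a / 2 := by linarith
      rw [sq_le_one_iff_abs_le_one, abs_le] at hy
      have hy2 := hy.2
      rw [div_mul_div_comm, div_le_one (by positivity)] at hy2
      by_contra hn
      nlinarith
  refine ⟨ha0, hα, fun h1 => key0.2 (hhalf 0 h1), fun ℓ _ _ h2 => ?_⟩
  exact (keyS ℓ (by omega)).2 (hhalf (ℓ + 1) h2)

end Stationary

/-! ### Counting the words of given weight before and after the accumulator -/

/-- The number of words of weight `w` which the accumulator turns into words of weight `h`. -/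
def weightCount (N w h : ℕ) : ℕ :=
  Finset.card {x : Fin N → ZMod 2 | hammingNorm x = w ∧ hammingNorm (accumulate x) = h}

lemma accumulate_snoc {N : ℕ} (x : Fin N → ZMod 2) (b : ZMod 2) :
    accumulate (Fin.snoc x b : Fin (N + 1) → ZMod 2) = Fin.snoc (accumulate x) (∑ i, x i + b) := by
  ext i
  induction i using Fin.lastCases with
  | last =>
    rw [Fin.snoc_last, accumulate, show Finset.Iic (Fin.last N) = Finset.univ from Finset.Iic_top,
      Fin.sum_univ_castSucc]
    simp
  | cast i => simp [accumulate, Fin.sum_Iic_castSucc]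

lemma hammingNorm_snoc {N : ℕ} (x : Fin N → ZMod 2) (b : ZMod 2) :
    hammingNorm (Fin.snoc x b : Fin (N + 1) → ZMod 2) = hammingNorm x + if b = 0 then 0 else 1 := by
  simp only [hammingNorm, Finset.card_filter, Fin.sum_univ_castSucc, Fin.snoc_castSucc,
    Fin.snoc_last, ne_eq, ite_not]

lemma zmod_two_ext : ∀ a b : ZMod 2, (a ≠ 0 ↔ b ≠ 0) → a = b := by decide

lemma hammingNorm_le {N : ℕ} (x : Fin N → ZMod 2) : hammingNorm x ≤ N := by
  simpa using hammingNorm_le_card_fintype (x := x)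

/-- The sum of all bits is the parity of the weight. -/
lemma sum_eq_hammingNorm {N : ℕ} (x : Fin N → ZMod 2) : ∑ i, x i = (hammingNorm x : ZMod 2) := by
  rw [hammingNorm, Finset.card_filter, Nat.cast_sum]
  refine Finset.sum_congr rfl fun i _ => ?_
  generalize x i = b
  revert b
  decide

lemma natCast_zmod_two_eq_zero (w : ℕ) : ((w : ZMod 2) = 0) ↔ Even w := by
  rw [ZMod.natCast_eq_zero_iff, even_iff_two_dvd]

lemma accumulate_injective : ∀ N : ℕ, Function.Injective (accumulate (N := N))
  | 0 => fun _ _ _ => Subsingleton.elim _ _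
  | N + 1 => fun x y h => by
    rw [← Fin.snoc_init_self x, ← Fin.snoc_init_self y, accumulate_snoc, accumulate_snoc] at h
    obtain ⟨h1, h2⟩ := Fin.snoc_inj.1 h
    have h3 := accumulate_injective N h1
    rw [h3] at h2
    rw [← Fin.snoc_init_self x, ← Fin.snoc_init_self y, h3, add_left_cancel h2]

lemma card_filter_snoc {N : ℕ} (p : (Fin (N + 1) → ZMod 2) → Prop) [DecidablePred p] :
    Finset.card {x | p x} = Finset.card {x : Fin N → ZMod 2 | p (Fin.snoc x 0)}
      + Finset.card {x : Fin N → ZMod 2 | p (Fin.snoc x 1)} := by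
  simp only [Finset.card_filter]
  rw [← (Fin.snocEquiv fun _ => ZMod 2).sum_comp, Fintype.sum_prod_type]
  exact Fin.sum_univ_two (fun b : ZMod 2 => ∑ x : Fin N → ZMod 2, if p (Fin.snoc x b) then 1 else 0)

lemma weightCount_eq_zero {N w h : ℕ} (hN : N < h) : weightCount N w h = 0 := by
  rw [weightCount, Finset.card_eq_zero, Finset.filter_eq_empty_iff]
  rintro x - ⟨-, h2⟩
  linarith [hammingNorm_le (accumulate x)]

/-- The contribution of a last input bit `b`: the last output bit is the parity of the weight. -/
lemma card_snoc_eq {N w h : ℕ} (b : ZMod 2) :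
    Finset.card {x : Fin N → ZMod 2 | hammingNorm (Fin.snoc x b : Fin (N + 1) → ZMod 2) = w ∧
      hammingNorm (accumulate (Fin.snoc x b : Fin (N + 1) → ZMod 2)) = h}
    = Finset.card {x : Fin N → ZMod 2 | hammingNorm x + (if b = 0 then 0 else 1) = w ∧
      hammingNorm (accumulate x) + (if Even w then 0 else 1) = h} := by
  congr 1
  ext x
  simp only [Finset.mem_filter, Finset.mem_univ, true_and, accumulate_snoc, hammingNorm_snoc]
  refine and_congr_right fun hw => ?_
  have : (∑ i, x i + b = 0) ↔ Even w := by
    rw [← hw, ← natCast_zmod_two_eq_zero, sum_eq_hammingNorm, Nat.cast_add]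
    have : ∀ b : ZMod 2, b = ((if b = 0 then 0 else 1 : ℕ) : ZMod 2) := by decide
    rw [← this b]
  simp only [this]

/-- Going through a word from left to right, the ones of the input start and end, in turn, the runs
of ones of the output. The starts are chosen among the `h` ones of the output, and the ends among
its `z` zeros. The proof is an induction on the length, by Pascal's rule. -/
theorem weightCount_le (N : ℕ) : ∀ w z h : ℕ, z + h = N →
    weightCount N w h ≤ z.choose (w / 2) * h.choose ((w + 1) / 2) := by
  induction N with
  | zero =>
    intro w z h hN
    obtain ⟨rfl, rfl⟩ : z = 0 ∧ h = 0 := by omega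
    rcases Nat.eq_zero_or_pos w with rfl | hw
    · exact Finset.card_le_one.2 fun _ _ _ _ => Subsingleton.elim _ _
    · rw [weightCount, Finset.card_eq_zero.2]
      · exact Nat.zero_le _
      · rw [Finset.filter_eq_empty_iff]
        rintro x - ⟨h1, -⟩
        have := hammingNorm_le x
        omega
  | succ N ih =>
    intro w z h hN
    have hrec : weightCount (N + 1) w h = _ := card_filter_snoc _
    rw [hrec, card_snoc_eq, card_snoc_eq]
    simp only [if_true, one_ne_zero, if_false, add_zero]
    rcases Nat.even_or_odd' w with ⟨j, rfl | rfl⟩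
    · rw [if_pos (even_two_mul j)]
      simp only [add_zero]
      rcases Nat.eq_zero_or_pos z with rfl | hz
      · have h1 : weightCount N (2 * j) h = 0 := weightCount_eq_zero (by omega)
        rw [weightCount] at h1
        rw [h1, Finset.card_eq_zero.2]
        · exact Nat.zero_le _
        · rw [Finset.filter_eq_empty_iff]
          rintro x - ⟨-, h2⟩
          have := hammingNorm_le (accumulate x)
          omega
      · obtain ⟨z, rfl⟩ : ∃ k, z = k + 1 := ⟨z - 1, by omega⟩
        have h1 := ih (2 * j) z h (by omega)
        rw [show 2 * j / 2 = j by omega, show (2 * j + 1) / 2 = j by omega] at h1 ⊢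
        rcases Nat.eq_zero_or_pos j with rfl | hj
        · have : Finset.card {x : Fin N → ZMod 2 | hammingNorm x + 1 = 2 * 0 ∧
              hammingNorm (accumulate x) = h} = 0 := by simp
          rw [this]
          simpa [weightCount] using h1
        · obtain ⟨j, rfl⟩ : ∃ k, j = k + 1 := ⟨j - 1, by omega⟩
          have h2 := ih (2 * j + 1) z h (by omega)
          rw [show (2 * j + 1) / 2 = j by omega, show (2 * j + 1 + 1) / 2 = j + 1 by omega] at h2
          have e : ∀ x : Fin N → ZMod 2, hammingNorm x + 1 = 2 * (j + 1) ↔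
              hammingNorm x = 2 * j + 1 := fun x => by omega
          simp only [e]
          rw [Nat.choose_succ_succ, add_mul, add_comm]
          exact add_le_add h2 h1
    · rw [if_neg (by simp)]
      rcases Nat.eq_zero_or_pos h with rfl | hh
      · simp
      · obtain ⟨h, rfl⟩ : ∃ k, h = k + 1 := ⟨h - 1, by omega⟩
        have h1 := ih (2 * j + 1) z h (by omega)
        have h2 := ih (2 * j) z h (by omega)
        simp only [Nat.add_right_cancel_iff]
        rw [show (2 * j + 1) / 2 = j by omega, show (2 * j + 1 + 1) / 2 = j + 1 by omega] at h1 ⊢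
        rw [show 2 * j / 2 = j by omega, show (2 * j + 1) / 2 = j by omega] at h2
        rw [Nat.choose_succ_succ, mul_add, add_comm]
        exact add_le_add h2 h1

lemma card_hammingNorm_eq (N w : ℕ) :
    Finset.card {x : Fin N → ZMod 2 | hammingNorm x = w} = N.choose w := by
  have h : (Finset.powersetCard w (Finset.univ : Finset (Fin N))).card = N.choose w := by
    rw [Finset.card_powersetCard, Finset.card_univ, Fintype.card_fin]
  rw [← h]
  refine Finset.card_nbij' (fun x => Finset.univ.filter fun i => x i ≠ 0)
    (fun s i => if i ∈ s then 1 else 0) ?_ ?_ ?_ ?_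
  · intro x hx
    simpa [hammingNorm, Finset.mem_powersetCard] using hx
  · intro s hs
    have hs' := (Finset.mem_powersetCard.1 hs).2
    simp [hammingNorm, hs']
  · intro x _
    funext i
    exact zmod_two_ext _ _ (by simp)
  · intro s _
    ext i
    simp

/-! ### Averaging over a random interleaver -/

/-- The probability that a uniformly permuted word of weight `w` is accumulated to a word of weight
`h`. -/
noncomputable def transProb (N w h : ℕ) : ℝ := (weightCount N w h : ℝ) / N.choose w

lemma transProb_nonneg (N w h : ℕ) : 0 ≤ transProb N w h := by unfold transProb; positivity

lemma sum_transProb_le_one (N w : ℕ) (s : Finset ℕ) : ∑ h ∈ s, transProb N w h ≤ 1 := by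
  unfold transProb
  rw [← Finset.sum_div]
  refine div_le_one_of_le₀ ?_ (by positivity)
  rw [← card_hammingNorm_eq, ← Nat.cast_sum]
  refine Nat.cast_le.2 ?_
  have := Finset.card_eq_sum_card_fiberwise (s := {x : Fin N → ZMod 2 | hammingNorm x = w ∧
    hammingNorm (accumulate x) ∈ s}) (t := s) (f := fun x => hammingNorm (accumulate x))
    (fun x hx => by simpa using (Finset.mem_filter.1 hx).2.2)
  calc ∑ h ∈ s, weightCount N w h
      = ∑ h ∈ s, Finset.card {x ∈ ({x : Fin N → ZMod 2 | hammingNorm x = w ∧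
          hammingNorm (accumulate x) ∈ s} : Finset _) | hammingNorm (accumulate x) = h} := by
        refine Finset.sum_congr rfl fun h hh => ?_
        rw [weightCount]
        congr 1
        ext x
        simp only [Finset.mem_filter, Finset.mem_univ, true_and]
        constructor
        · rintro ⟨h1, rfl⟩; exact ⟨⟨h1, hh⟩, rfl⟩
        · rintro ⟨⟨h1, -⟩, h2⟩; exact ⟨h1, h2⟩
    _ = _ := this.symm
    _ ≤ _ := Finset.card_le_card (Finset.monotone_filter_right _ fun x _ hx => hx.1)

/-- Words of equal weight are permutations of each other. -/
lemma exists_perm_of_hammingNorm_eq {N : ℕ} {x y : Fin N → ZMod 2}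
    (h : hammingNorm x = hammingNorm y) : ∃ τ : Equiv.Perm (Fin N), x = y ∘ τ := by
  have hc : Fintype.card {i // x i ≠ 0} = Fintype.card {i // y i ≠ 0} := by
    simpa [hammingNorm, Fintype.card_subtype] using h
  let e := Fintype.equivOfCardEq hc
  refine ⟨e.extendSubtype, funext fun i => zmod_two_ext _ _ ⟨fun hi => ?_, fun hi => ?_⟩⟩
  · exact e.extendSubtype_mem i hi
  · exact fun hn => e.extendSubtype_not_mem i (not_not.2 hn) hi

lemma card_perm_eq {N : ℕ} (x : Fin N → ZMod 2) (h : ℕ) :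
    (Finset.card {σ : Equiv.Perm (Fin N) | hammingNorm (accumulate (x ∘ σ)) = h} : ℝ)
      = Fintype.card (Equiv.Perm (Fin N)) * transProb N (hammingNorm x) h := by
  set w := hammingNorm x
  have hsame : ∀ y : Fin N → ZMod 2, hammingNorm y = w →
      Finset.card {σ : Equiv.Perm (Fin N) | hammingNorm (accumulate (y ∘ σ)) = h}
      = Finset.card {σ : Equiv.Perm (Fin N) | hammingNorm (accumulate (x ∘ σ)) = h} := by
    intro y hy
    obtain ⟨τ, rfl⟩ := exists_perm_of_hammingNorm_eq hy
    refine Finset.card_equiv (Equiv.mulLeft τ) fun σ => ?_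
    simp [Function.comp_assoc]
  have hcomp : ∀ σ : Equiv.Perm (Fin N), ∀ y : Fin N → ZMod 2,
      hammingNorm (y ∘ σ) = hammingNorm y := by
    intro σ y
    exact Finset.card_equiv σ fun i => by simp
  -- count the pairs of a word of weight `w` and a permutation in two ways
  have hdouble : N.choose w *
      Finset.card {σ : Equiv.Perm (Fin N) | hammingNorm (accumulate (x ∘ σ)) = h}
      = Fintype.card (Equiv.Perm (Fin N)) * weightCount N w h := by
    calc _ = ∑ y : Fin N → ZMod 2 with hammingNorm y = w, Finset.card
            {σ : Equiv.Perm (Fin N) | hammingNorm (accumulate (y ∘ σ)) = h} := by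
          rw [Finset.sum_congr rfl fun y hy => hsame y (Finset.mem_filter.1 hy).2,
            Finset.sum_const, card_hammingNorm_eq, smul_eq_mul]
      _ = ∑ σ : Equiv.Perm (Fin N), Finset.card
            {y : Fin N → ZMod 2 | hammingNorm y = w ∧ hammingNorm (accumulate (y ∘ σ)) = h} := by
          simp only [Finset.card_filter, ite_and, Finset.sum_filter]
          rw [Finset.sum_comm]
          refine Finset.sum_congr rfl fun y _ => ?_
          split_ifs <;> simp
      _ = ∑ σ : Equiv.Perm (Fin N), weightCount N w h := by
          refine Finset.sum_congr rfl fun σ _ => ?_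
          refine Finset.card_equiv (Equiv.arrowCongr σ.symm (Equiv.refl _)) fun y => ?_
          have : (Equiv.arrowCongr σ.symm (Equiv.refl (ZMod 2))) y = y ∘ σ := by
            ext i; simp
          simp only [Finset.mem_filter, Finset.mem_univ, true_and, this, hcomp]
      _ = _ := by simp
  have hch : (0 : ℝ) < N.choose w := by
    exact_mod_cast Nat.choose_pos (hammingNorm_le x)
  unfold transProb
  rw [mul_div_assoc', eq_div_iff hch.ne', mul_comm]
  exact_mod_cast hdouble

/-- The expected number of nonzero information words whose encoding by `ℓ` accumulators has
weight `h`. -/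
noncomputable def meanCount (q K ℓ h : ℕ) : ℝ :=
  (∑ π : Fin ℓ → Equiv.Perm (Fin (K * q)),
    (Finset.card {u : Fin K → ZMod 2 | u ≠ 0 ∧ hammingNorm (rmaEncode ℓ π u) = h} : ℝ))
    / (Fintype.card (Equiv.Perm (Fin (K * q))) : ℝ) ^ ℓ

lemma meanCount_nonneg (q K ℓ h : ℕ) : 0 ≤ meanCount q K ℓ h := by unfold meanCount; positivity

theorem meanCount_succ (q K ℓ h : ℕ) : meanCount q K (ℓ + 1) h
    = ∑ w ∈ Finset.range (K * q + 1), meanCount q K ℓ w * transProb (K * q) w h := by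
  set P : ℝ := (Fintype.card (Equiv.Perm (Fin (K * q))) : ℝ) with hP
  have hPpos : 0 < P := by rw [hP]; exact_mod_cast Fintype.card_pos
  have hnum : ∑ π : Fin (ℓ + 1) → Equiv.Perm (Fin (K * q)),
      (Finset.card {u : Fin K → ZMod 2 | u ≠ 0 ∧ hammingNorm (rmaEncode (ℓ + 1) π u) = h} : ℝ)
      = P * ∑ w ∈ Finset.range (K * q + 1), (∑ π : Fin ℓ → Equiv.Perm (Fin (K * q)),
        (Finset.card {u : Fin K → ZMod 2 | u ≠ 0 ∧ hammingNorm (rmaEncode ℓ π u) = w} : ℝ))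
          * transProb (K * q) w h := by
    rw [← (Fin.snocEquiv fun _ => Equiv.Perm (Fin (K * q))).sum_comp, Fintype.sum_prod_type_right]
    have hswap : P * ∑ w ∈ Finset.range (K * q + 1),
        (∑ π : Fin ℓ → Equiv.Perm (Fin (K * q)), (Finset.card {u : Fin K → ZMod 2 | u ≠ 0 ∧
          hammingNorm (rmaEncode ℓ π u) = w} : ℝ)) * transProb (K * q) w h
        = ∑ π : Fin ℓ → Equiv.Perm (Fin (K * q)), P * ∑ w ∈ Finset.range (K * q + 1),
          (Finset.card {u : Fin K → ZMod 2 | u ≠ 0 ∧ hammingNorm (rmaEncode ℓ π u) = w} : ℝ)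
            * transProb (K * q) w h := by
      simp only [Finset.sum_mul]
      rw [Finset.sum_comm, Finset.mul_sum]
    rw [hswap]
    refine Finset.sum_congr rfl fun π _ => ?_
    have henc : ∀ (σ : Equiv.Perm (Fin (K * q))) (u : Fin K → ZMod 2),
        rmaEncode (ℓ + 1) (Fin.snocEquiv (fun _ => Equiv.Perm (Fin (K * q))) (σ, π)) u
          = accumulate (rmaEncode ℓ π u ∘ σ) := by
      intro σ u
      simp only [rmaEncode, Fin.snocEquiv_apply, Fin.snoc_castSucc, Fin.snoc_last]
      rfl
    simp only [henc]
    calc ∑ σ : Equiv.Perm (Fin (K * q)), (Finset.card {u : Fin K → ZMod 2 | u ≠ 0 ∧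
            hammingNorm (accumulate (rmaEncode ℓ π u ∘ σ)) = h} : ℝ)
        = ∑ u : Fin K → ZMod 2 with u ≠ 0, (Finset.card {σ : Equiv.Perm (Fin (K * q)) |
            hammingNorm (accumulate (rmaEncode ℓ π u ∘ σ)) = h} : ℝ) := by
          simp only [Finset.card_filter, ite_and, Finset.sum_filter, Nat.cast_sum]
          rw [Finset.sum_comm]
          refine Finset.sum_congr rfl fun u _ => ?_
          split_ifs <;> simp
      _ = ∑ u : Fin K → ZMod 2 with u ≠ 0,
            P * transProb (K * q) (hammingNorm (rmaEncode ℓ π u)) h :=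
          Finset.sum_congr rfl fun u _ => card_perm_eq _ h
      _ = P * ∑ w ∈ Finset.range (K * q + 1), ∑ u : Fin K → ZMod 2 with
            u ≠ 0 ∧ hammingNorm (rmaEncode ℓ π u) = w, transProb (K * q) w h := by
          rw [← Finset.mul_sum]
          congr 1
          rw [← Finset.sum_fiberwise_of_maps_to
            (s := ({u | u ≠ 0} : Finset (Fin K → ZMod 2))) (t := Finset.range (K * q + 1))
            (g := fun u => hammingNorm (rmaEncode ℓ π u))
            (fun u _ => Finset.mem_range.2 (Nat.lt_succ_of_le (hammingNorm_le _)))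
            (fun u => transProb (K * q) (hammingNorm (rmaEncode ℓ π u)) h)]
          refine Finset.sum_congr rfl fun w _ => ?_
          rw [Finset.filter_filter]
          exact Finset.sum_congr rfl fun u hu => by rw [(Finset.mem_filter.1 hu).2.2]
      _ = _ := by
          congr 1
          refine Finset.sum_congr rfl fun w _ => ?_
          rw [Finset.sum_const, nsmul_eq_mul]
  unfold meanCount
  rw [hnum, pow_succ', mul_div_mul_left _ _ hPpos.ne', Finset.sum_div]
  exact Finset.sum_congr rfl fun w _ => by rw [mul_div_right_comm]

lemma repeatWord_apply {K : ℕ} (q : ℕ) (u : Fin K → ZMod 2) (i : Fin K) (j : Fin q) :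
    repeatWord q u (finProdFinEquiv (i, j)) = u i :=
  congrArg u (congrArg Prod.fst (finProdFinEquiv.symm_apply_apply (i, j)))

lemma hammingNorm_repeatWord {K : ℕ} (q : ℕ) (u : Fin K → ZMod 2) :
    hammingNorm (repeatWord q u) = hammingNorm u * q := by
  rw [hammingNorm, hammingNorm, Finset.card_filter, Finset.card_filter, ← finProdFinEquiv.sum_comp,
    Fintype.sum_prod_type, Finset.sum_mul]
  refine Finset.sum_congr rfl fun i _ => ?_
  simp only [repeatWord_apply, Finset.sum_const, Finset.card_univ, Fintype.card_fin, smul_eq_mul,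
    mul_comm]

lemma meanCount_zero_mul {q K k : ℕ} (hq : 0 < q) (hk : 0 < k) :
    meanCount q K 0 (k * q) = K.choose k := by
  unfold meanCount
  have : ∀ u : Fin K → ZMod 2, (u ≠ 0 ∧ hammingNorm (repeatWord q u) = k * q) ↔
      hammingNorm u = k := by
    intro u
    rw [hammingNorm_repeatWord, Nat.mul_left_inj hq.ne']
    constructor
    · exact fun h => h.2
    · rintro rfl
      exact ⟨hammingNorm_pos_iff.1 hk, rfl⟩
  simp only [rmaEncode, this, card_hammingNorm_eq]
  simp

lemma exists_of_meanCount_zero_ne {q K w : ℕ} (h : meanCount q K 0 w ≠ 0) :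
    ∃ k, 0 < k ∧ k ≤ K ∧ w = k * q := by
  by_contra hn
  refine h ?_
  unfold meanCount
  rw [Finset.sum_eq_zero, zero_div]
  intro π _
  rw [Nat.cast_eq_zero, Finset.card_eq_zero, Finset.filter_eq_empty_iff]
  rintro u - ⟨hu, hw⟩
  rw [rmaEncode, hammingNorm_repeatWord] at hw
  exact hn ⟨hammingNorm u, hammingNorm_pos_iff.2 hu, hammingNorm_le u, hw.symm⟩

/-! ### The minimum distance and the expected number of light codewords -/

lemma rmaEncode_zero {K q : ℕ} (M : ℕ) (π : Fin M → Equiv.Perm (Fin (K * q))) :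
    rmaEncode M π 0 = 0 := by
  induction M with
  | zero => rfl
  | succ M ih =>
    rw [rmaEncode, ih]
    ext i
    simp [accumulate]

lemma rmaEncode_injective {K q : ℕ} (hq : 0 < q) (M : ℕ)
    (π : Fin M → Equiv.Perm (Fin (K * q))) : Function.Injective (rmaEncode M π) := by
  induction M with
  | zero =>
    intro u v h
    ext i
    have := congrFun h (finProdFinEquiv (i, ⟨0, hq⟩))
    simpa only [rmaEncode, repeatWord_apply] using this
  | succ M ih =>
    intro u v h
    refine ih (fun ℓ => π ℓ.castSucc) (funext fun i => ?_)
    have := congrFun (accumulate_injective _ h) ((π (Fin.last M)).symm i)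
    simpa using this

lemma exists_light_of_codeMinDist_lt {K q M : ℕ} (hq : 0 < q) (hK : 0 < K)
    {π : Fin M → Equiv.Perm (Fin (K * q))} {x : ℝ} (h : (codeMinDist (rmaCode π) : ℝ) < x) :
    ∃ u : Fin K → ZMod 2, u ≠ 0 ∧ (hammingNorm (rmaEncode M π u) : ℝ) < x := by
  have hne : {d : ℕ | ∃ c ∈ rmaCode π, c ≠ 0 ∧ hammingNorm c = d}.Nonempty := by
    let u : Fin K → ZMod 2 := fun _ => 1
    have hu : u ≠ 0 := fun he => one_ne_zero (congrFun he ⟨0, hK⟩)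
    refine ⟨_, rmaEncode M π u, ⟨u, rfl⟩, fun he => hu ?_, rfl⟩
    exact rmaEncode_injective hq M π (he.trans (rmaEncode_zero M π).symm)
  obtain ⟨c, ⟨u, rfl⟩, hc, hd⟩ := Nat.sInf_mem hne
  refine ⟨u, fun he => hc (by rw [he, rmaEncode_zero]), ?_⟩
  rw [hd]
  exact h

/-- The first moment bound. -/
theorem one_sub_rmaFraction_le {q M K : ℕ} (hq : 0 < q) (hK : 0 < K) (x : ℝ) (s : Finset ℕ)
    (hs : ∀ h : ℕ, h ≤ K * q → (h : ℝ) < x → h ∈ s) :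
    1 - rmaFraction q M K (fun C => x ≤ (codeMinDist C : ℝ)) ≤ ∑ h ∈ s, meanCount q K M h := by
  classical
  set P : ℝ := (Fintype.card (Equiv.Perm (Fin (K * q))) : ℝ) with hP
  have hPpos : 0 < P := by rw [hP]; exact_mod_cast Fintype.card_pos
  let E := Fin M → Equiv.Perm (Fin (K * q))
  let A : E → ℕ → ℝ := fun π h =>
    (Finset.card {u : Fin K → ZMod 2 | u ≠ 0 ∧ hammingNorm (rmaEncode M π u) = h} : ℝ)
  have hA : ∀ π h, 0 ≤ A π h := fun π h => Nat.cast_nonneg _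
  have hbad : ∀ π : E, ¬ x ≤ (codeMinDist (rmaCode π) : ℝ) → 1 ≤ ∑ h ∈ s, A π h := by
    intro π hx
    obtain ⟨u, hu, hux⟩ := exists_light_of_codeMinDist_lt hq hK (not_le.1 hx)
    refine le_trans ?_ (Finset.single_le_sum (fun h _ => hA π h) (hs _ (hammingNorm_le _) hux))
    exact Nat.one_le_cast.2
      (Finset.card_pos.2 ⟨u, Finset.mem_filter.2 ⟨Finset.mem_univ u, hu, rfl⟩⟩)
  have hcard : (Nat.card E : ℝ) = P ^ M := by
    rw [Nat.card_eq_fintype_card, Fintype.card_fun, Fintype.card_fin, Nat.cast_pow]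
  have hgood : (Nat.card {π : E // x ≤ (codeMinDist (rmaCode π) : ℝ)} : ℝ)
      = ((Finset.univ.filter fun π : E => x ≤ (codeMinDist (rmaCode π) : ℝ)).card : ℝ) := by
    rw [Nat.card_eq_fintype_card, Fintype.card_subtype]
  have htot : (Nat.card E : ℝ) =
      ((Finset.univ.filter fun π : E => x ≤ (codeMinDist (rmaCode π) : ℝ)).card : ℝ)
      + ((Finset.univ.filter fun π : E => ¬ x ≤ (codeMinDist (rmaCode π) : ℝ)).card : ℝ) := by
    rw [← Nat.cast_add, Finset.card_filter_add_card_filter_not, Nat.card_eq_fintype_card,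
      Finset.card_univ]
  have hsum : ((Finset.univ.filter fun π : E => ¬ x ≤ (codeMinDist (rmaCode π) : ℝ)).card : ℝ)
      ≤ ∑ h ∈ s, ∑ π : E, A π h := by
    rw [Finset.sum_comm]
    calc _ = ∑ π : E with ¬ x ≤ (codeMinDist (rmaCode π) : ℝ), (1 : ℝ) := by
          rw [Finset.sum_const, nsmul_one]
      _ ≤ ∑ π : E with ¬ x ≤ (codeMinDist (rmaCode π) : ℝ), ∑ h ∈ s, A π h :=
          Finset.sum_le_sum fun π hπ => hbad π (Finset.mem_filter.1 hπ).2
      _ ≤ _ := Finset.sum_le_sum_of_subset_of_nonneg (Finset.subset_univ _)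
          fun π _ _ => Finset.sum_nonneg fun h _ => hA π h
  have hmean : ∑ h ∈ s, meanCount q K M h = (∑ h ∈ s, ∑ π : E, A π h) / P ^ M := by
    rw [Finset.sum_div]
    rfl
  rw [hmean, rmaFraction, hgood, le_div_iff₀ (by positivity), ← hcard, sub_mul, one_mul,
    div_mul_cancel₀ _ (by rw [hcard]; positivity)]
  linarith

/-! ### Bounds on binomial coefficients -/

/-- The binomial distribution with mean `a` on `a + m` trials has its mode at `a`. -/
lemma choose_mul_pow_le (a m k : ℕ) :
    (a + m).choose k * a ^ k * m ^ (a + m - k) ≤ (a + m).choose a * a ^ a * m ^ m := by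
  have step : ∀ k, k + 1 ≤ a + m → ((a + m).choose (k + 1) * a ^ (k + 1) * m ^ (a + m - (k + 1)))
      * ((k + 1) * m) = ((a + m).choose k * a ^ k * m ^ (a + m - k)) * ((a + m - k) * a) := by
    intro k hk
    have h1 := Nat.choose_succ_right_eq (a + m) k
    rw [show a + m - k = (a + m - (k + 1)) + 1 by omega] at h1 ⊢
    rw [pow_succ a, pow_succ m]
    calc _ = ((a + m).choose (k + 1) * (k + 1)) * (a ^ k * a * m ^ (a + m - (k + 1)) * m) := by ring
      _ = _ := by rw [h1]; ring
  rcases le_total k a with hka | hka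
  · have down : ∀ j, j ≤ a → (a + m).choose (a - j) * a ^ (a - j) * m ^ (a + m - (a - j))
        ≤ (a + m).choose a * a ^ a * m ^ m := by
      intro j
      induction j with
      | zero => intro _; rw [Nat.sub_zero, Nat.add_sub_cancel_left]
      | succ j ih =>
        intro hj
        refine le_trans ?_ (ih (by omega))
        rcases Nat.eq_zero_or_pos m with rfl | hm
        · rw [zero_pow (by omega)]; simp
        have h := step (a - (j + 1)) (by omega)
        rw [show a - (j + 1) + 1 = a - j by omega] at h
        have h2 : (a - j) * m ≤ (a + m - (a - (j + 1))) * a := by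
          rw [mul_comm]; exact Nat.mul_le_mul (by omega) (by omega)
        refine Nat.le_of_mul_le_mul_right ?_ (Nat.mul_pos (show 0 < a - j by omega) hm)
        rw [h]
        exact Nat.mul_le_mul_left _ h2
    have := down (a - k) (by omega)
    rwa [show a - (a - k) = k by omega] at this
  · have up : ∀ j, (a + m).choose (a + j) * a ^ (a + j) * m ^ (a + m - (a + j))
        ≤ (a + m).choose a * a ^ a * m ^ m := by
      intro j
      induction j with
      | zero => rw [Nat.add_zero, Nat.add_sub_cancel_left]
      | succ j ih =>
        refine le_trans ?_ ih
        rcases Nat.lt_or_ge (a + m) (a + (j + 1)) with hlt | hle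
        · rw [Nat.choose_eq_zero_of_lt hlt]; simp
        have h := step (a + j) (by omega)
        have h2 : (a + m - (a + j)) * a ≤ (a + j + 1) * m := by
          rw [mul_comm]; exact Nat.mul_le_mul (by omega) (by omega)
        refine Nat.le_of_mul_le_mul_right ?_ (Nat.mul_pos (show 0 < a + j + 1 by omega)
          (show 0 < m by omega))
        rw [← add_assoc, h]
        exact Nat.mul_le_mul_left _ h2
    have := up (k - a)
    rwa [show a + (k - a) = k by omega] at this

lemma pow_le_choose_mul (a m : ℕ) :
    (a + m) ^ (a + m) ≤ (a + m + 1) * ((a + m).choose a * a ^ a * m ^ m) := by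
  rw [add_pow a m (a + m)]
  calc ∑ k ∈ Finset.range (a + m + 1), a ^ k * m ^ (a + m - k) * (a + m).choose k
      ≤ ∑ k ∈ Finset.range (a + m + 1), (a + m).choose a * a ^ a * m ^ m :=
        Finset.sum_le_sum fun k _ => by
          calc _ = (a + m).choose k * a ^ k * m ^ (a + m - k) := by ring
            _ ≤ _ := choose_mul_pow_le a m k
    _ = _ := by rw [Finset.sum_const, Finset.card_range, smul_eq_mul]

lemma choose_mul_prob_le_one (a m : ℕ) {p : ℝ} (hp : 0 ≤ p) (hp1 : p ≤ 1) :
    ((a + m).choose a : ℝ) * (p ^ a * (1 - p) ^ m) ≤ 1 := by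
  have h := add_pow p (1 - p) (a + m)
  rw [add_sub_cancel, one_pow] at h
  have hq : 0 ≤ 1 - p := by linarith
  have := Finset.single_le_sum
    (f := fun k => p ^ k * (1 - p) ^ (a + m - k) * ((a + m).choose k : ℝ))
    (fun k _ => by positivity) (Finset.mem_range.2 (show a < a + m + 1 by omega))
  rw [← h] at this
  simp only [Nat.add_sub_cancel_left] at this
  linarith

lemma one_le_choose_mul_prob {a m : ℕ} (h : 0 < a + m) :
    1 ≤ ((a + m : ℕ) + 1 : ℝ) * ((a + m).choose a *
      (((a : ℝ) / (a + m : ℕ)) ^ a * (1 - (a : ℝ) / (a + m : ℕ)) ^ m)) := by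
  have hN : (0 : ℝ) < (a + m : ℕ) := by exact_mod_cast h
  have e : 1 - (a : ℝ) / (a + m : ℕ) = m / (a + m : ℕ) := by
    rw [one_sub_div hN.ne']; push_cast; ring_nf
  rw [e, div_pow, div_pow, div_mul_div_comm, ← pow_add, mul_div_assoc', mul_div_assoc',
    one_le_div (by positivity)]
  calc ((a + m : ℕ) : ℝ) ^ (a + m)
      ≤ (((a + m + 1) * ((a + m).choose a * a ^ a * m ^ m) : ℕ) : ℝ) := by
        exact_mod_cast pow_le_choose_mul a m
    _ = _ := by push_cast; ring

lemma exp_massEntropy (a m : ℕ) : Real.exp (massEntropy a m) *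
    (((a : ℝ) / (a + m : ℕ)) ^ a * (1 - (a : ℝ) / (a + m : ℕ)) ^ m) = 1 := by
  rcases Nat.eq_zero_or_pos a with rfl | ha
  · simp [massEntropy]
  rcases Nat.eq_zero_or_pos m with rfl | hm
  · have : (a : ℝ) ≠ 0 := by positivity
    simp [massEntropy, this]
  have ha' : (0 : ℝ) < a := by exact_mod_cast ha
  have hm' : (0 : ℝ) < m := by exact_mod_cast hm
  have e : 1 - (a : ℝ) / (a + m) = m / (a + m) := by field_simp; ring
  rw [massEntropy_eq ha' hm']
  push_cast
  have h1 : 0 < (a : ℝ) / (a + m) := by positivity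
  have h2 : 0 < 1 - (a : ℝ) / (a + m) := by rw [e]; positivity
  nth_rewrite 3 [← Real.exp_log h1]
  nth_rewrite 2 [← Real.exp_log h2]
  rw [← Real.exp_nat_mul, ← Real.exp_nat_mul, ← Real.exp_add, ← Real.exp_add,
    Real.exp_eq_one_iff]
  ring

lemma choose_le_exp (a m : ℕ) : ((a + m).choose a : ℝ) ≤ Real.exp (massEntropy a m) := by
  have hp1 : (a : ℝ) / (a + m : ℕ) ≤ 1 := div_le_one_of_le₀ (by push_cast; simp) (by positivity)
  have h := choose_mul_prob_le_one a m (p := (a : ℝ) / (a + m : ℕ)) (by positivity) hp1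
  have e := exp_massEntropy a m
  have hpos : 0 < ((a : ℝ) / (a + m : ℕ)) ^ a * (1 - (a : ℝ) / (a + m : ℕ)) ^ m := by
    by_contra hn
    nlinarith [Real.exp_pos (massEntropy a m)]
  exact le_of_mul_le_mul_right (h.trans e.ge) hpos

lemma exp_le_choose (a m : ℕ) :
    Real.exp (massEntropy a m) ≤ ((a + m : ℕ) + 1) * ((a + m).choose a : ℝ) := by
  rcases Nat.eq_zero_or_pos (a + m) with h0 | h0
  · obtain ⟨rfl, rfl⟩ : a = 0 ∧ m = 0 := by omega
    simp [massEntropy]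
  have h := one_le_choose_mul_prob h0
  have e := exp_massEntropy a m
  have hpos : 0 < ((a : ℝ) / (a + m : ℕ)) ^ a * (1 - (a : ℝ) / (a + m : ℕ)) ^ m := by
    by_contra hn
    nlinarith [Real.exp_pos (massEntropy a m)]
  exact le_of_mul_le_mul_right (by rw [mul_assoc]; exact e.le.trans h) hpos

lemma massEntropy_mul (c u v : ℝ) : massEntropy (c * u) (c * v) = c * massEntropy u v := by
  unfold massEntropy
  rw [← mul_add, Real.negMulLog_mul, Real.negMulLog_mul, Real.negMulLog_mul]
  ring

/-! ### Bounds on the transition probabilities -/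

lemma transProb_le {N w h : ℕ} (hh : h ≤ N) : transProb N w h
    ≤ (N - h).choose (w / 2) * h.choose ((w + 1) / 2) / N.choose w := by
  unfold transProb
  refine div_le_div_of_nonneg_right ?_ (by positivity)
  exact_mod_cast weightCount_le N w (N - h) h (by omega)

/-- An accumulator at most halves the weight, up to rounding, and so does the accumulator followed
by complementation. -/
lemma le_of_transProb_ne_zero {N w h : ℕ} (hh : h ≤ N) (hne : transProb N w h ≠ 0) :
    (w + 1) / 2 ≤ h ∧ w / 2 ≤ N - h := by
  constructor
  · by_contra hn
    have := transProb_le (w := w) hh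
    rw [Nat.choose_eq_zero_of_lt (n := h) (by omega)] at this
    exact hne (le_antisymm (by simpa using this) (transProb_nonneg N w h))
  · by_contra hn
    have := transProb_le (w := w) hh
    rw [Nat.choose_eq_zero_of_lt (n := N - h) (by omega)] at this
    exact hne (le_antisymm (by simpa using this) (transProb_nonneg N w h))

lemma choose_half_eq (w : ℕ) : (w.choose (w / 2) : ℝ)
    = w.factorial / ((w / 2).factorial * ((w + 1) / 2).factorial) := by
  rw [Nat.cast_choose ℝ (Nat.div_le_self w 2), show w - w / 2 = (w + 1) / 2 by omega]

lemma choose_half_le (w : ℕ) : (w.choose (w / 2) : ℝ) ≤ 2 ^ w := by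
  exact_mod_cast Nat.choose_le_two_pow w (w / 2)

/-- The bound used for outputs of small weight. -/
lemma transProb_le_pow {N w h : ℕ} (hN : 0 < N) (hh : 4 * h ≤ N) :
    transProb N w h ≤ 4 ^ w * ((h : ℝ) / N) ^ ((w + 1) / 2) := by
  by_cases hne : transProb N w h = 0
  · rw [hne]; positivity
  have hwh := (le_of_transProb_ne_zero (by omega) hne).1
  have hNr : (0 : ℝ) < N := by exact_mod_cast hN
  refine (transProb_le (by omega)).trans ?_
  set s := w / 2 with hs
  set t := (w + 1) / 2 with ht
  have hst : s + t = w := by omega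
  have b1 : ((N - h).choose s : ℝ) ≤ (N : ℝ) ^ s / s.factorial := by
    refine (Nat.choose_le_pow_div s (N - h)).trans ?_
    gcongr
    exact Nat.sub_le N h
  have b2 : (h.choose t : ℝ) ≤ (h : ℝ) ^ t / t.factorial := Nat.choose_le_pow_div t h
  have b3 : ((N : ℝ) / 2) ^ w / w.factorial ≤ N.choose w := by
    refine le_trans ?_ (Nat.pow_le_choose (α := ℝ) w N)
    gcongr
    rw [div_le_iff₀ (by norm_num)]
    have : N ≤ (N + 1 - w) * 2 := by omega
    exact_mod_cast this
  have hcw := choose_half_eq w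
  rw [← hs, ← ht] at hcw
  calc ((N - h).choose s : ℝ) * h.choose t / N.choose w
      ≤ ((N : ℝ) ^ s / s.factorial) * ((h : ℝ) ^ t / t.factorial)
        / (((N : ℝ) / 2) ^ w / w.factorial) := by gcongr
    _ = (w.choose s : ℝ) * 2 ^ w * ((h : ℝ) / N) ^ t := by
        rw [hcw, div_pow, div_pow, ← hst, pow_add (N : ℝ)]
        field_simp
    _ ≤ 2 ^ w * 2 ^ w * ((h : ℝ) / N) ^ t := by
        gcongr
        exact choose_half_le w
    _ = _ := by rw [← mul_pow]; norm_num

/-- The multinomial coefficient, factored in two ways: this exchanges the roles of the input and the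
output weight. -/
lemma choose_mul_choose_div (s t c d : ℕ) :
    ((s + d).choose s : ℝ) * (t + c).choose t / (t + c + (s + d)).choose (s + t)
      = (s + t).choose s * (c + d).choose c / (t + c + (s + d)).choose (t + c) := by
  have e : t + c + (s + d) = (s + t) + (c + d) := by omega
  rw [Nat.cast_add_choose, Nat.cast_add_choose, Nat.cast_add_choose, Nat.cast_add_choose,
    Nat.cast_add_choose, e, Nat.cast_add_choose]
  have := Nat.factorial_ne_zero
  field_simp

/-- For output weights up to `r N`, `r < 1 / 2`, the probability decays geometrically in the input
weight. The factor `N + 1` is harmless once the input weight exceeds logarithmic order. -/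
lemma transProb_le_geom {N w h : ℕ} (hh0 : 0 < h) {r : ℝ} (hr : r ≤ 1 / 2)
    (hh : (h : ℝ) ≤ r * N) :
    transProb N w h ≤ 2 * (N + 1) * (4 * r * (1 - r)) ^ (w / 2) := by
  have hh0' : (0 : ℝ) < h := by exact_mod_cast hh0
  have hN0 : (0 : ℝ) < N := by
    by_contra hn
    have : (N : ℝ) = 0 := le_antisymm (not_lt.1 hn) (by positivity)
    rw [this, mul_zero] at hh
    linarith
  have hr0 : 0 < r := by
    by_contra hn
    nlinarith
  have hhN : h ≤ N := by
    have : (h : ℝ) ≤ N := by nlinarith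
    exact_mod_cast this
  have hθ : 0 ≤ 4 * r * (1 - r) := by nlinarith
  by_cases hne : transProb N w h = 0
  · rw [hne]; positivity
  obtain ⟨h1, h2⟩ := le_of_transProb_ne_zero hhN hne
  refine (transProb_le hhN).trans ?_
  set s := w / 2 with hs
  set t := (w + 1) / 2 with ht
  obtain ⟨c, rfl⟩ : ∃ c, h = t + c := ⟨h - t, by omega⟩
  obtain ⟨d, rfl⟩ : ∃ d, N = t + c + (s + d) := ⟨N - (t + c) - s, by omega⟩
  rw [Nat.add_sub_cancel_left]
  have hw : w = s + t := by omega
  have hch : ((t + c + (s + d)).choose w : ℝ) = (t + c + (s + d)).choose (s + t) := by rw [hw]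
  rw [hch, choose_mul_choose_div]
  set N := t + c + (s + d) with hN
  set b : ℝ := ((t + c : ℕ) : ℝ) / N with hb
  have hbr : b ≤ r := by rw [hb, div_le_iff₀ hN0]; exact hh
  have hb0 : 0 < b := by positivity
  have hb1 : 0 < 1 - b := by linarith
  have k1 := choose_mul_prob_le_one c d hb0.le (by linarith : b ≤ 1)
  have k2 := one_le_choose_mul_prob (a := t + c) (m := s + d) (by omega)
  rw [← hN, ← hb] at k2
  have hC : (0 : ℝ) < N.choose (t + c) := by exact_mod_cast Nat.choose_pos hhN
  have k3 : ((c + d).choose c : ℝ) / N.choose (t + c) ≤ (N + 1) * (b ^ t * (1 - b) ^ s) := by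
    rw [div_le_iff₀ hC]
    have hx : 0 < b ^ c * (1 - b) ^ d := by positivity
    refine le_of_mul_le_mul_right (k1.trans (k2.trans (le_of_eq ?_))) hx
    rw [pow_add b, pow_add (1 - b)]
    ring
  -- one factor `2` and one factor `b ≤ 1` are lost if `w` is odd
  have k4 : 2 ^ (s + t) * (b ^ t * (1 - b) ^ s) ≤ 2 * (4 * b * (1 - b)) ^ s := by
    have e : (4 * b * (1 - b)) ^ s = 2 ^ s * 2 ^ s * (b ^ s * (1 - b) ^ s) := by
      rw [mul_pow, mul_pow, ← mul_pow 2 2]; norm_num; ring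
    have hX : 0 ≤ 2 ^ s * 2 ^ s * (b ^ s * (1 - b) ^ s) := by positivity
    rcases (by omega : t = s ∨ t = s + 1) with hts | hts
    · rw [hts, e, pow_add]; linarith
    · rw [hts, e, pow_add, pow_succ, pow_succ]
      nlinarith
  have k5 : (4 * b * (1 - b)) ^ s ≤ (4 * r * (1 - r)) ^ s := by
    refine pow_le_pow_left₀ (by positivity) ?_ s
    nlinarith
  have hcs := choose_half_le w
  rw [← hs, hw] at hcs
  have hcs' : ((s + t).choose s : ℝ) ≤ 2 ^ (s + t) := hcs
  calc ((s + t).choose s : ℝ) * (c + d).choose c / N.choose (t + c)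
      = (s + t).choose s * (((c + d).choose c : ℝ) / N.choose (t + c)) := by ring
    _ ≤ 2 ^ (s + t) * ((N + 1) * (b ^ t * (1 - b) ^ s)) := by gcongr
    _ = (N + 1) * (2 ^ (s + t) * (b ^ t * (1 - b) ^ s)) := by ring
    _ ≤ (N + 1) * (2 * (4 * r * (1 - r)) ^ s) :=
        mul_le_mul_of_nonneg_left (k4.trans (mul_le_mul_of_nonneg_left k5 two_pos.le))
          (by positivity)
    _ = _ := by ring

lemma stepExponent_eq_choose (a b : ℝ) : stepExponent a b =
    massEntropy (a / 2) (1 - b - a / 2) + massEntropy (a / 2) (b - a / 2)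
      - massEntropy a (1 - a) := by
  rw [← binEntropy_eq_massEntropy]
  unfold stepExponent massEntropy
  rw [Real.binEntropy_eq_negMulLog_add_negMulLog_one_sub,
    Real.binEntropy_eq_negMulLog_add_negMulLog_one_sub,
    show a / 2 + (1 - b - a / 2) = 1 - b by ring, show a / 2 + (b - a / 2) = b by ring]
  have : Real.negMulLog a = 2 * Real.negMulLog (a / 2) - a * Real.log 2 := by
    rw [div_eq_mul_inv, Real.negMulLog_mul, Real.negMulLog, Real.negMulLog, Real.log_inv]
    ring
  rw [this]
  ring

lemma abs_sub_half_lt {s t n δ : ℝ} (hn : 0 < n) (hδ : 1 / n < δ) (h : t = s ∨ t = s + 1) :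
    |s / n - (s + t) / n / 2| < δ ∧ |t / n - (s + t) / n / 2| < δ := by
  have hp : 0 < 1 / n := by positivity
  rcases h with rfl | rfl
  · rw [show t / n - (t + t) / n / 2 = 0 by ring, abs_zero]
    exact ⟨hp.trans hδ, hp.trans hδ⟩
  · rw [show s / n - (s + (s + 1)) / n / 2 = -(1 / n / 2) by ring,
      show (s + 1) / n - (s + (s + 1)) / n / 2 = 1 / n / 2 by ring, abs_neg,
      abs_of_pos (half_pos hp)]
    exact ⟨by linarith, by linarith⟩

/-- The bound used for weights of linear order. The error `τ` comes from the rounding of `w / 2`. -/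
lemma transProb_le_exp {τ : ℝ} (hτ : 0 < τ) : ∃ N₀ : ℕ, ∀ N ≥ N₀, ∀ w ≤ N, ∀ h ≤ N,
    transProb N w h ≤ (N + 1) * Real.exp (N * (stepExponent ((w : ℝ) / N) ((h : ℝ) / N) + τ)) := by
  have huc : UniformContinuousOn Real.negMulLog (Set.Icc (-1) 1) :=
    isCompact_Icc.uniformContinuousOn_of_continuous Real.continuous_negMulLog.continuousOn
  obtain ⟨δ, hδ, hη⟩ := Metric.uniformContinuousOn_iff.1 huc (τ / 4) (by positivity)
  obtain ⟨N₁, hN₁⟩ := exists_nat_gt (1 / δ)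
  refine ⟨max N₁ 1, fun N hN w hw h hh => ?_⟩
  have hN0 : 0 < N := by have := le_max_right N₁ 1; omega
  have hNr : (0 : ℝ) < N := by exact_mod_cast hN0
  have hNδ : 1 / (N : ℝ) < δ := by
    have : (N₁ : ℝ) ≤ N := by exact_mod_cast (le_max_left N₁ 1).trans hN
    rw [div_lt_iff₀ hNr]
    rw [div_lt_iff₀ hδ] at hN₁
    nlinarith
  by_cases hne : transProb N w h = 0
  · rw [hne]; positivity
  obtain ⟨h1, h2⟩ := le_of_transProb_ne_zero hh hne
  refine (transProb_le hh).trans ?_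
  set s := w / 2 with hs
  set t := (w + 1) / 2 with ht
  have hw2 : w = s + t := by omega
  have hts : t = s ∨ t = s + 1 := by omega
  obtain ⟨c, hc⟩ : ∃ c, h = t + c := ⟨h - t, by omega⟩
  obtain ⟨d, hd⟩ : ∃ d, N - h = s + d := ⟨N - h - s, by omega⟩
  obtain ⟨e, he⟩ : ∃ e, N = w + e := ⟨N - w, by omega⟩
  have u1 := choose_le_exp s d
  have u2 := choose_le_exp t c
  have u3 := exp_le_choose w e
  rw [← he] at u3
  rw [← hd] at u1
  rw [← hc] at u2
  -- rescale all masses by `N`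
  set a : ℝ := (w : ℝ) / N with ha
  set b : ℝ := (h : ℝ) / N with hb
  have hcast : ∀ x : ℝ, x = N * (x / N) := fun x => by field_simp
  have hdR : (d : ℝ) / N = 1 - b - s / N := by
    have : (N : ℝ) = h + s + d := by
      have : N = h + s + d := by omega
      exact_mod_cast this
    rw [hb]; field_simp; linarith
  have hcR : (c : ℝ) / N = b - t / N := by
    have : (h : ℝ) = t + c := by exact_mod_cast hc
    rw [hb, this]; field_simp; ring
  have heR : (e : ℝ) / N = 1 - a := by
    have : (N : ℝ) = w + e := by exact_mod_cast he
    rw [ha]; field_simp; linarith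
  rw [hcast s, hcast d, massEntropy_mul, hdR] at u1
  rw [hcast t, hcast c, massEntropy_mul, hcR] at u2
  rw [hcast w, hcast e, massEntropy_mul, heR, ← ha] at u3
  have hC : (0 : ℝ) < N.choose w := by exact_mod_cast Nat.choose_pos hw
  have hexp : ((N - h).choose s : ℝ) * h.choose t / N.choose w ≤ (N + 1) * Real.exp (N *
      (massEntropy (s / N) (1 - b - s / N) + massEntropy (t / N) (b - t / N)
        - massEntropy a (1 - a))) := by
    rw [div_le_iff₀ hC]
    calc ((N - h).choose s : ℝ) * h.choose t
        ≤ Real.exp (N * massEntropy (s / N) (1 - b - s / N))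
          * Real.exp (N * massEntropy (t / N) (b - t / N)) :=
          mul_le_mul u1 u2 (Nat.cast_nonneg _) (Real.exp_nonneg _)
      _ = Real.exp (N * (massEntropy (s / N) (1 - b - s / N) + massEntropy (t / N) (b - t / N)
        - massEntropy a (1 - a))) * Real.exp (N * massEntropy a (1 - a)) := by
          rw [← Real.exp_add, ← Real.exp_add]; ring_nf
      _ ≤ Real.exp (N * (massEntropy (s / N) (1 - b - s / N) + massEntropy (t / N) (b - t / N)
        - massEntropy a (1 - a))) * ((N + 1) * N.choose w) :=
          mul_le_mul_of_nonneg_left u3 (Real.exp_nonneg _)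
      _ = _ := by ring
  refine hexp.trans ?_
  gcongr
  rw [stepExponent_eq_choose]
  -- it remains to replace `s / N` and `t / N` by `a / 2`
  have hstR : (w : ℝ) = s + t := by exact_mod_cast hw2
  have hsa : |(s : ℝ) / N - a / 2| < δ ∧ |(t : ℝ) / N - a / 2| < δ := by
    have hts' : (t : ℝ) = s ∨ (t : ℝ) = s + 1 := by
      rcases hts with h | h
      · left; exact_mod_cast h
      · right; exact_mod_cast h
    rw [ha, hstR]
    exact abs_sub_half_lt hNr hNδ hts'
  have ha0 : 0 ≤ a := by positivity
  have ha1 : a ≤ 1 := by rw [ha, div_le_one hNr]; exact_mod_cast hw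
  have hb0 : 0 ≤ b := by positivity
  have hb1 : b ≤ 1 := by rw [hb, div_le_one hNr]; exact_mod_cast hh
  have hs0 : (0 : ℝ) ≤ s / N := by positivity
  have ht0 : (0 : ℝ) ≤ t / N := by positivity
  have hd0 : (0 : ℝ) ≤ d / N := by positivity
  have hc0 : (0 : ℝ) ≤ c / N := by positivity
  rw [hdR] at hd0
  rw [hcR] at hc0
  have close : ∀ x y : ℝ, x ∈ Set.Icc (-1 : ℝ) 1 → y ∈ Set.Icc (-1 : ℝ) 1 → |x - y| < δ →
      Real.negMulLog x ≤ Real.negMulLog y + τ / 4 := by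
    intro x y hx hy hxy
    have := hη x hx y hy (by rwa [Real.dist_eq])
    rw [Real.dist_eq, abs_lt] at this
    linarith [this.2]
  have c1 := close (s / N) (a / 2) ⟨by linarith, by linarith⟩ ⟨by linarith, by linarith⟩ hsa.1
  have c2 := close (t / N) (a / 2) ⟨by linarith, by linarith⟩ ⟨by linarith, by linarith⟩ hsa.2
  have c3 := close (1 - b - s / N) (1 - b - a / 2) ⟨by linarith, by linarith⟩
    ⟨by linarith, by linarith⟩ (by
      rw [show 1 - b - (s : ℝ) / N - (1 - b - a / 2) = -((s : ℝ) / N - a / 2) by ring, abs_neg]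
      exact hsa.1)
  have c4 := close (b - t / N) (b - a / 2) ⟨by linarith, by linarith⟩
    ⟨by linarith, by linarith⟩ (by
      rw [show b - (t : ℝ) / N - (b - a / 2) = -((t : ℝ) / N - a / 2) by ring, abs_neg]
      exact hsa.2)
  unfold massEntropy
  rw [show (s : ℝ) / N + (1 - b - s / N) = 1 - b by ring,
    show (t : ℝ) / N + (b - t / N) = b by ring,
    show a / 2 + (1 - b - a / 2) = 1 - b by ring, show a / 2 + (b - a / 2) = b by ring]
  linarith

/-! ### Weights of linear order -/

/-- The vectors of normalized weights that violate the constraints of the stages by at most `δ`. The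
weights of actual words lie in this set for `δ = 1 / N`. -/
def relaxedRegion (M : ℕ) (δ : ℝ) : Set (Fin (M + 1) → ℝ) :=
  {γ | (∀ i, 0 ≤ γ i ∧ γ i ≤ 1) ∧
    ∀ ℓ : Fin M, γ ℓ.castSucc ≤ 2 * γ ℓ.succ + δ ∧ γ ℓ.castSucc ≤ 2 * (1 - γ ℓ.succ) + δ}

lemma relaxedRegion_mono {M : ℕ} {δ δ' : ℝ} (h : δ ≤ δ') :
    relaxedRegion M δ ⊆ relaxedRegion M δ' := fun _ hγ =>
  ⟨hγ.1, fun ℓ => ⟨by linarith [(hγ.2 ℓ).1], by linarith [(hγ.2 ℓ).2]⟩⟩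

lemma isClosed_relaxedRegion (M : ℕ) :
    IsClosed {p : (Fin (M + 1) → ℝ) × ℝ | p.1 ∈ relaxedRegion M p.2} := by
  change IsClosed {p : (Fin (M + 1) → ℝ) × ℝ | (∀ i, 0 ≤ p.1 i ∧ p.1 i ≤ 1) ∧
    ∀ ℓ : Fin M, p.1 ℓ.castSucc ≤ 2 * p.1 ℓ.succ + p.2 ∧
      p.1 ℓ.castSucc ≤ 2 * (1 - p.1 ℓ.succ) + p.2}
  simp only [Set.ofPred_and, Set.ofPred_forall]
  refine (isClosed_iInter fun i => (isClosed_le ?_ ?_).inter (isClosed_le ?_ ?_)).inter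
    (isClosed_iInter fun ℓ => (isClosed_le ?_ ?_).inter (isClosed_le ?_ ?_)) <;> fun_prop

/-- Below the growth rate bound the exponent is bounded away from zero, even for slightly relaxed
constraints, as long as the input of the last accumulator has linear weight. -/
theorem exists_relaxed_bound {q m : ℕ} {r ε : ℝ} (hr : r < rmaGrowthBound q (m + 1)) (hε : 0 < ε) :
    ∃ δ > 0, ∀ γ ∈ relaxedRegion (m + 1) δ, γ (Fin.last _) ≤ r → ε ≤ γ (Fin.last m).castSucc →
      chainExponent q (m + 1) γ ≤ -δ := by
  -- the pairs `(γ, δ)` that violate the claim; `δ` attains its minimum on this compact set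
  set X : Set ((Fin (m + 2) → ℝ) × ℝ) := {p | (0 ≤ p.2 ∧ p.2 ≤ 1) ∧
    p.1 ∈ relaxedRegion (m + 1) p.2 ∧
    p.1 (Fin.last _) ≤ r ∧ ε ≤ p.1 (Fin.last m).castSucc ∧ -p.2 ≤ chainExponent q (m + 1) p.1}
    with hX
  have hXc : IsCompact X := by
    refine (isCompact_Icc (a := ((0 : Fin (m + 2) → ℝ), (0 : ℝ)))
      (b := ((1 : Fin (m + 2) → ℝ), (1 : ℝ)))).of_isClosed_subset ?_ ?_
    · rw [hX]
      simp only [Set.ofPred_and]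
      refine ((isClosed_le ?_ ?_).inter (isClosed_le ?_ ?_)).inter
        ((isClosed_relaxedRegion (m + 1)).inter
        ((isClosed_le ?_ ?_).inter ((isClosed_le ?_ ?_).inter (isClosed_le ?_ ?_)))) <;> fun_prop
    · rintro ⟨γ, δ⟩ ⟨hδ, hγ, -⟩
      exact ⟨⟨fun i => (hγ.1 i).1, hδ.1⟩, ⟨fun i => (hγ.1 i).2, hδ.2⟩⟩
  have key : ∃ δ₀ > 0, δ₀ ≤ 1 ∧ ∀ p ∈ X, δ₀ ≤ p.2 := by
    rcases X.eq_empty_or_nonempty with he | hne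
    · exact ⟨1, one_pos, le_rfl, fun p hp => by rw [he] at hp; exact hp.elim⟩
    obtain ⟨p, hp, hmin⟩ := hXc.exists_isMinOn hne continuous_snd.continuousOn
    refine ⟨p.2, lt_of_le_of_ne hp.1.1 fun h0 => ?_, hp.1.2, fun p' hp' => hmin hp'⟩
    obtain ⟨-, hγ, hl, hw, hF⟩ := hp
    rw [← h0] at hγ hF
    have hc : p.1 ∈ closedRegion (m + 1) := ⟨(hγ.1 0).1, fun ℓ => step_iff.2
      ⟨by linarith [(hγ.2 ℓ).1], by linarith [(hγ.2 ℓ).2]⟩⟩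
    rcases hc.1.eq_or_lt with hz | hz
    · have := chainExponent_neg_of_zero (q := q) hc hz.symm
        (by linarith [rmaGrowthBound_le_half q (m + 1)]) (by linarith)
      linarith
    · have := rmaExponent_neg (last_pos hc hz) (hl.trans_lt hr) ⟨hz, rfl, hc.2⟩
      rw [rmaExponent_eq hc] at this
      linarith
  obtain ⟨δ₀, hδ₀, hδ₁, hmin⟩ := key
  refine ⟨δ₀ / 2, half_pos hδ₀, fun γ hγ hl hw => ?_⟩
  by_contra hn
  have := hmin (γ, δ₀ / 2) ⟨⟨by positivity, by simp only; linarith⟩, hγ, hl, hw, (not_le.1 hn).le⟩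
  simp only at this
  linarith

lemma chainExponent_snoc (q ℓ : ℕ) (γ : Fin (ℓ + 1) → ℝ) (b : ℝ) :
    chainExponent q (ℓ + 1) (Fin.snoc γ b) =
      chainExponent q ℓ γ + stepExponent (γ (Fin.last ℓ)) b := by
  unfold chainExponent
  rw [Fin.sum_univ_castSucc, ← add_assoc]
  have h0 : (Fin.snoc γ b : Fin (ℓ + 2) → ℝ) 0 = γ 0 := Fin.snoc_castSucc (α := fun _ => ℝ) b γ 0
  simp only [Fin.succ_castSucc, Fin.snoc_castSucc, Fin.succ_last, Fin.snoc_last, h0]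

/-- A chain of weights `γ`, ending in `h / N`, whose exponent bounds `x` up to a factor
`(N + 1) ^ n` and an error `τ` per stage. -/
def ChainBound (q N ℓ h : ℕ) (τ : ℝ) (n : ℕ) (x : ℝ) (γ : Fin (ℓ + 1) → ℝ) : Prop :=
  γ ∈ relaxedRegion ℓ (1 / N) ∧ γ (Fin.last ℓ) = (h : ℝ) / N ∧
    x ≤ ((N : ℝ) + 1) ^ n * Real.exp (N * (chainExponent q ℓ γ + ℓ * τ))

lemma ChainBound.snoc {q N ℓ w h n : ℕ} {τ x : ℝ} {γ : Fin (ℓ + 1) → ℝ} (hN : 0 < N)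
    (hγ : ChainBound q N ℓ w τ n x γ) (hh : h ≤ N) (hne : transProb N w h ≠ 0)
    (hstep : transProb N w h
      ≤ (N + 1) * Real.exp (N * (stepExponent ((w : ℝ) / N) ((h : ℝ) / N) + τ))) :
    ChainBound q N (ℓ + 1) h τ (n + 1) (x * transProb N w h) (Fin.snoc γ ((h : ℝ) / N)) := by
  obtain ⟨⟨hbox, hcon⟩, hlast, hx⟩ := hγ
  have hNr : (0 : ℝ) < N := by exact_mod_cast hN
  refine ⟨⟨fun i => ?_, fun i => ?_⟩, Fin.snoc_last (α := fun _ => ℝ) _ _, ?_⟩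
  · induction i using Fin.lastCases with
    | last =>
      rw [Fin.snoc_last]
      exact ⟨by positivity, by rw [div_le_one hNr]; exact_mod_cast hh⟩
    | cast i => rw [Fin.snoc_castSucc]; exact hbox i
  · induction i using Fin.lastCases with
    | last =>
      rw [Fin.snoc_castSucc, Fin.succ_last, Fin.snoc_last, hlast]
      obtain ⟨h1, h2⟩ := le_of_transProb_ne_zero hh hne
      have h1' : (w : ℝ) ≤ 2 * h := by
        have : w ≤ 2 * h := by omega
        exact_mod_cast this
      have h2' : (w : ℝ) + 2 * h ≤ 2 * N + 1 := by
        have : w + 2 * h ≤ 2 * N + 1 := by omega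
        exact_mod_cast this
      constructor
      · rw [mul_div_assoc', ← add_div, div_le_div_iff_of_pos_right hNr]; linarith
      · rw [one_sub_div hNr.ne', mul_div_assoc', ← add_div, div_le_div_iff_of_pos_right hNr]
        linarith
    | cast i =>
      rw [Fin.snoc_castSucc, Fin.succ_castSucc, Fin.snoc_castSucc]
      exact hcon i
  · rw [chainExponent_snoc, hlast]
    have h0 := transProb_nonneg N w h
    calc x * transProb N w h
        ≤ (((N : ℝ) + 1) ^ n * Real.exp (N * (chainExponent q ℓ γ + ℓ * τ))) *
          ((N + 1) * Real.exp (N * (stepExponent ((w : ℝ) / N) ((h : ℝ) / N) + τ))) :=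
          mul_le_mul hx hstep h0 (by positivity)
      _ = ((N : ℝ) + 1) ^ (n + 1) * (Real.exp (N * (chainExponent q ℓ γ + ℓ * τ)) *
          Real.exp (N * (stepExponent ((w : ℝ) / N) ((h : ℝ) / N) + τ))) := by ring
      _ = _ := by
          rw [← Real.exp_add]
          push_cast
          ring_nf

/-- The expected number of words of given weight is dominated by a single chain of weights. -/
theorem exists_chainBound {q : ℕ} (hq : 0 < q) {τ : ℝ} {K : ℕ} (hK : 0 < K)
    (hstep : ∀ w ≤ K * q, ∀ h ≤ K * q, transProb (K * q) w h ≤ ((K * q : ℕ) + 1) *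
      Real.exp ((K * q : ℕ) * (stepExponent ((w : ℝ) / (K * q : ℕ)) ((h : ℝ) / (K * q : ℕ)) + τ)))
    (ℓ : ℕ) : ∀ h ≤ K * q, meanCount q K ℓ h ≠ 0 →
      ∃ γ, ChainBound q (K * q) ℓ h τ (2 * ℓ) (meanCount q K ℓ h) γ := by
  have hN : 0 < K * q := Nat.mul_pos hK hq
  have hNr : (0 : ℝ) < (K * q : ℕ) := by exact_mod_cast hN
  induction ℓ with
  | zero =>
    intro h hh hne
    obtain ⟨k, hk, hkK, rfl⟩ := exists_of_meanCount_zero_ne hne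
    refine ⟨fun _ => ((k * q : ℕ) : ℝ) / (K * q : ℕ), ⟨fun _ => ⟨by positivity, ?_⟩,
      fun i => i.elim0⟩, rfl, ?_⟩
    · rw [div_le_one hNr]; exact_mod_cast hh
    · rw [meanCount_zero_mul hq hk]
      obtain ⟨j, rfl⟩ : ∃ j, K = k + j := ⟨K - k, by omega⟩
      have hKr : ((k : ℝ) + j) ≠ 0 := by
        have : ((k + j : ℕ) : ℝ) ≠ 0 := by exact_mod_cast hK.ne'
        push_cast at this
        exact this
      have hqr : (q : ℝ) ≠ 0 := by exact_mod_cast hq.ne'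
      refine (choose_le_exp k j).trans (le_of_eq ?_)
      unfold chainExponent
      rw [binEntropy_eq_massEntropy]
      simp only [Finset.univ_eq_empty, Finset.sum_empty, mul_zero, pow_zero, one_mul, add_zero,
        CharP.cast_eq_zero, zero_mul]
      congr 1
      push_cast
      rw [mul_div_mul_right _ _ hqr, mul_div_assoc', mul_right_comm, mul_div_cancel_right₀ _ hqr,
        ← massEntropy_mul]
      congr 1 <;> field_simp
      ring
  | succ ℓ ih =>
    intro h hh hne
    rw [meanCount_succ] at hne ⊢
    obtain ⟨w, hw, hmax⟩ := Finset.exists_max_image (Finset.range (K * q + 1))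
      (fun w => meanCount q K ℓ w * transProb (K * q) w h) ⟨0, by simp⟩
    have hwN : w ≤ K * q := Nat.lt_succ_iff.1 (Finset.mem_range.1 hw)
    have hle : ∑ w ∈ Finset.range (K * q + 1), meanCount q K ℓ w * transProb (K * q) w h
        ≤ ((K * q : ℕ) + 1) * (meanCount q K ℓ w * transProb (K * q) w h) := by
      have := Finset.sum_le_card_nsmul _ _ _ hmax
      rw [Finset.card_range, nsmul_eq_mul] at this
      push_cast at this ⊢
      exact this
    have hne' : meanCount q K ℓ w * transProb (K * q) w h ≠ 0 := fun h0 => by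
      rw [h0, mul_zero] at hle
      exact hne (le_antisymm hle (Finset.sum_nonneg fun w _ =>
        mul_nonneg (meanCount_nonneg _ _ _ _) (transProb_nonneg _ _ _)))
    obtain ⟨γ, hγ⟩ := ih w hwN (left_ne_zero_of_mul hne')
    obtain ⟨h1, h2, h3⟩ := hγ.snoc hN hh (right_ne_zero_of_mul hne') (hstep w hwN h hh)
    refine ⟨_, h1, h2, hle.trans ?_⟩
    calc _ ≤ (((K * q : ℕ) : ℝ) + 1) * _ := mul_le_mul_of_nonneg_left h3 (by positivity)
      _ = _ := by ring

/-! ### Weights of small order -/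

lemma meanCount_weight_zero {q : ℕ} (hq : 0 < q) (K ℓ : ℕ) : meanCount q K ℓ 0 = 0 := by
  unfold meanCount
  rw [Finset.sum_eq_zero, zero_div]
  intro π _
  rw [Nat.cast_eq_zero, Finset.card_eq_zero, Finset.filter_eq_empty_iff]
  rintro u - ⟨hu, hw⟩
  refine hu (rmaEncode_injective hq ℓ π ?_)
  rw [rmaEncode_zero, hammingNorm_eq_zero.1 hw]

/-- The first accumulator: since every bit is repeated at least twice, the number of information
words is compensated by the probability of a small output weight. -/
lemma meanCount_one_le {q K h : ℕ} (hq : 2 ≤ q) (hK : 0 < K) (hh : 4 * h ≤ K * q) :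
    meanCount q K 1 h ≤ 48 ^ h := by
  have hN : 0 < K * q := Nat.mul_pos hK (by omega)
  have hNr : (0 : ℝ) < (K * q : ℕ) := by exact_mod_cast hN
  rw [meanCount_succ]
  have hterm : ∀ k ∈ Finset.range (K + 1), meanCount q K 0 (k * q) * transProb (K * q) (k * q) h
      ≤ 16 ^ h * ((h : ℝ) ^ k / k.factorial) := by
    intro k _
    rcases Nat.eq_zero_or_pos k with rfl | hk
    · rw [zero_mul, meanCount_weight_zero (by omega), zero_mul]; positivity
    by_cases hne : transProb (K * q) (k * q) h = 0
    · rw [hne, mul_zero]; positivity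
    have h1 := (le_of_transProb_ne_zero (by omega) hne).1
    have hkq : k * 2 ≤ k * q := Nat.mul_le_mul_left k hq
    rw [meanCount_zero_mul (by omega) hk]
    have hx1 : (h : ℝ) / (K * q : ℕ) ≤ 1 := by
      rw [div_le_one hNr]
      exact_mod_cast (by omega : h ≤ K * q)
    calc (K.choose k : ℝ) * transProb (K * q) (k * q) h
        ≤ (((K * q : ℕ) : ℝ) ^ k / k.factorial) * (16 ^ h * ((h : ℝ) / (K * q : ℕ)) ^ k) := by
          refine mul_le_mul ?_ ?_ (transProb_nonneg _ _ _) (by positivity)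
          · refine (Nat.choose_le_pow_div k K).trans ?_
            gcongr
            exact Nat.le_mul_of_pos_right K (by omega)
          · refine (transProb_le_pow hN hh).trans (mul_le_mul ?_ ?_ (by positivity) (by positivity))
            · calc (4 : ℝ) ^ (k * q) ≤ 4 ^ (2 * h) := pow_le_pow_right₀ (by norm_num) (by omega)
                _ = 16 ^ h := by rw [pow_mul]; norm_num
            · exact pow_le_pow_of_le_one (by positivity) hx1 (by omega)
      _ = 16 ^ h * ((h : ℝ) ^ k / k.factorial) := by
          rw [div_pow]; field_simp
  calc ∑ w ∈ Finset.range (K * q + 1), meanCount q K 0 w * transProb (K * q) w h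
      = ∑ w ∈ (Finset.range (K + 1)).image (· * q), meanCount q K 0 w * transProb (K * q) w h := by
        refine (Finset.sum_subset ?_ ?_).symm
        · intro w hw
          obtain ⟨k, hk, rfl⟩ := Finset.mem_image.1 hw
          exact Finset.mem_range.2 (Nat.lt_succ_of_le
            (Nat.mul_le_mul_right q (Nat.lt_succ_iff.1 (Finset.mem_range.1 hk))))
        · intro w _ hw
          by_contra hne
          obtain ⟨k, _, hk, rfl⟩ := exists_of_meanCount_zero_ne (left_ne_zero_of_mul hne)
          exact hw (Finset.mem_image.2 ⟨k, Finset.mem_range.2 (Nat.lt_succ_of_le hk), rfl⟩)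
    _ = ∑ k ∈ Finset.range (K + 1), meanCount q K 0 (k * q) * transProb (K * q) (k * q) h :=
        Finset.sum_image fun a _ b _ hab => Nat.eq_of_mul_eq_mul_right (by omega : 0 < q) hab
    _ ≤ ∑ k ∈ Finset.range (K + 1), 16 ^ h * ((h : ℝ) ^ k / k.factorial) :=
        Finset.sum_le_sum hterm
    _ = 16 ^ h * ∑ k ∈ Finset.range (K + 1), (h : ℝ) ^ k / k.factorial := by rw [Finset.mul_sum]
    _ ≤ 16 ^ h * Real.exp h := by
        gcongr
        exact Real.sum_le_exp_of_nonneg (by positivity) _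
    _ ≤ 16 ^ h * 3 ^ h := by
        gcongr
        rw [← Real.exp_one_pow]
        exact pow_le_pow_left₀ (Real.exp_pos 1).le (by linarith [Real.exp_one_lt_d9]) h
    _ = 48 ^ h := by rw [← mul_pow]; norm_num

/-- For small weights, the expected number of words after `ℓ` accumulators is at most exponential in
the weight, uniformly in the code length. -/
def ExpBounded (q ℓ : ℕ) : Prop :=
  ∃ D ε : ℝ, 1 ≤ D ∧ 0 < ε ∧ ∀ K h : ℕ, 0 < K → (h : ℝ) ≤ ε * (K * q : ℕ) →
    meanCount q K ℓ h ≤ D ^ h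

/-- For small weights, the expected number of words is at most proportional to the relative weight;
in particular few words have bounded weight. -/
def LinBounded (q ℓ : ℕ) : Prop :=
  ∃ C ε : ℝ, 0 ≤ C ∧ 0 < ε ∧ ∀ K h : ℕ, 0 < K → (h : ℝ) ≤ ε * (K * q : ℕ) →
    meanCount q K ℓ h ≤ C * (h / (K * q : ℕ))

/-- One more accumulator turns the exponential bound into the linear one, because even a single one
in its input is unlikely to give a small output weight. -/
lemma ExpBounded.succ {q ℓ : ℕ} (hq : 0 < q) (h : ExpBounded q ℓ) : LinBounded q (ℓ + 1) := by
  obtain ⟨D, ε, hD, hε, hb⟩ := h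
  have hB : 0 < (4 * D) ^ 2 := by positivity
  refine ⟨8 * (4 * D) ^ 2, min (1 / 4) (min (ε / 2) (1 / (4 * (4 * D) ^ 2))), by positivity,
    by positivity, fun K h hK hh => ?_⟩
  have hN : 0 < K * q := Nat.mul_pos hK hq
  have hNr : (0 : ℝ) < (K * q : ℕ) := by exact_mod_cast hN
  have h4 : 4 * h ≤ K * q := by
    have : (h : ℝ) ≤ 1 / 4 * (K * q : ℕ) := hh.trans (by gcongr; exact min_le_left _ _)
    have : (4 : ℝ) * h ≤ (K * q : ℕ) := by linarith
    exact_mod_cast this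
  have h2 : (h : ℝ) ≤ ε / 2 * (K * q : ℕ) :=
    hh.trans (by gcongr; exact (min_le_right _ _).trans (min_le_left _ _))
  set x : ℝ := (h : ℝ) / (K * q : ℕ) with hx
  have hx0 : 0 ≤ x := by positivity
  have hBx : (4 * D) ^ 2 * x ≤ 1 / 4 := by
    have h5 : (h : ℝ) ≤ 1 / (4 * (4 * D) ^ 2) * (K * q : ℕ) :=
      hh.trans (by gcongr; exact (min_le_right _ _).trans (min_le_right _ _))
    have h6 : x ≤ 1 / (4 * (4 * D) ^ 2) := by rw [hx, div_le_iff₀ hNr]; exact h5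
    calc (4 * D) ^ 2 * x ≤ (4 * D) ^ 2 * (1 / (4 * (4 * D) ^ 2)) := by gcongr
      _ = 1 / 4 := by field_simp
  rw [meanCount_succ]
  have hterm : ∀ w ∈ Finset.range (K * q + 1), meanCount q K ℓ w * transProb (K * q) w h
      ≤ (4 * (4 * D) ^ 2 * x) * (1 / 2) ^ w := by
    intro w _
    rcases Nat.eq_zero_or_pos w with rfl | hw
    · rw [meanCount_weight_zero hq, zero_mul]; positivity
    by_cases hne : transProb (K * q) w h = 0
    · rw [hne, mul_zero]; positivity
    have h1 := (le_of_transProb_ne_zero (by omega) hne).1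
    have hw2 : (w : ℝ) ≤ 2 * h := by exact_mod_cast (by omega : w ≤ 2 * h)
    have e1 := hb K w hK (by linarith)
    have e2 := transProb_le_pow (w := w) hN h4
    obtain ⟨t, ht⟩ : ∃ t, (w + 1) / 2 = t + 1 := ⟨(w + 1) / 2 - 1, by omega⟩
    rw [ht] at e2
    have h1D : 1 ≤ 4 * D := by linarith
    calc meanCount q K ℓ w * transProb (K * q) w h ≤ D ^ w * (4 ^ w * x ^ (t + 1)) :=
          mul_le_mul e1 e2 (transProb_nonneg _ _ _) (by positivity)
      _ = (4 * D) ^ w * x ^ (t + 1) := by rw [mul_pow]; ring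
      _ ≤ (4 * D) ^ (2 * (t + 1)) * x ^ (t + 1) := by
          gcongr
          omega
      _ = ((4 * D) ^ 2 * x) * ((4 * D) ^ 2 * x) ^ t := by rw [pow_mul, ← mul_pow, pow_succ']
      _ ≤ ((4 * D) ^ 2 * x) * (1 / 4) ^ t := by gcongr
      _ = (4 * (4 * D) ^ 2 * x) * (1 / 2) ^ (2 * (t + 1)) := by
          rw [pow_mul, pow_succ]; norm_num; ring
      _ ≤ (4 * (4 * D) ^ 2 * x) * (1 / 2) ^ w := by
          refine mul_le_mul_of_nonneg_left ?_ (by positivity)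
          exact pow_le_pow_of_le_one (by norm_num) (by norm_num) (by omega)
  calc _ ≤ ∑ w ∈ Finset.range (K * q + 1), (4 * (4 * D) ^ 2 * x) * (1 / 2 : ℝ) ^ w :=
        Finset.sum_le_sum hterm
    _ = (4 * (4 * D) ^ 2 * x) * ∑ w ∈ Finset.range (K * q + 1), (1 / 2 : ℝ) ^ w := by
        rw [Finset.mul_sum]
    _ ≤ (4 * (4 * D) ^ 2 * x) * 2 := by
        gcongr
        exact sum_geometric_two_le _
    _ = _ := by ring

lemma LinBounded.expBounded {q ℓ : ℕ} (hq : 0 < q) (h : LinBounded q ℓ) : ExpBounded q ℓ := by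
  obtain ⟨C, ε, hC, hε, hb⟩ := h
  refine ⟨max C 1, min ε 1, le_max_right _ _, by positivity, fun K h hK hh => ?_⟩
  rcases Nat.eq_zero_or_pos h with rfl | h0
  · rw [meanCount_weight_zero hq]; positivity
  have hNr : (0 : ℝ) < (K * q : ℕ) := by exact_mod_cast Nat.mul_pos hK hq
  have h1 := hb K h hK (hh.trans (by gcongr; exact min_le_left _ _))
  have h2 : (h : ℝ) / (K * q : ℕ) ≤ 1 := by
    rw [div_le_one hNr]
    exact hh.trans (by nlinarith [min_le_right ε 1])
  calc meanCount q K ℓ h ≤ C * (h / (K * q : ℕ)) := h1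
    _ ≤ C * 1 := by gcongr
    _ ≤ max C 1 := by rw [mul_one]; exact le_max_left _ _
    _ ≤ max C 1 ^ h := le_self_pow₀ (le_max_right _ _) h0.ne'

lemma expBounded_one {q : ℕ} (hq : 2 ≤ q) : ExpBounded q 1 :=
  ⟨48, 1 / 4, by norm_num, by norm_num, fun K h hK hh => meanCount_one_le hq hK (by
    have : (4 : ℝ) * h ≤ (K * q : ℕ) := by linarith
    exact_mod_cast this)⟩

/-- From the second accumulator on, light words are rare. -/
theorem linBounded {q : ℕ} (hq : 2 ≤ q) (ℓ : ℕ) : LinBounded q (ℓ + 2) := by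
  induction ℓ with
  | zero => exact (expBounded_one hq).succ (by omega)
  | succ ℓ ih => exact (ih.expBounded (by omega)).succ (by omega)

/-! ### The expected number of light codewords tends to zero -/

/-- The three contributions to the expected number of light codewords: the input of the last
accumulator has weight at most `T`, of small order above `T`, or of linear order. -/
theorem sum_meanCount_le {q m : ℕ} (hq : 2 ≤ q) {r : ℝ} (hr0 : 0 < r)
    (hr : r < rmaGrowthBound q (m + 3)) : ∃ C ε c : ℝ, 0 ≤ C ∧ 0 < ε ∧ 0 < c ∧ ∃ N₀ : ℕ,
      ∀ K T : ℕ, 0 < K → N₀ ≤ K * q → (T : ℝ) ≤ ε * (K * q : ℕ) →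
      ∑ h ∈ Finset.range (K * q + 1) with ((h : ℕ) : ℝ) ≤ r * (K * q : ℕ), meanCount q K (m + 3) h
        ≤ (T + 1) * (C * (T / (K * q : ℕ)))
          + (C * (2 * ((K * q : ℕ) + 1) ^ 3 * (4 * r * (1 - r)) ^ (T / 2))
          + ((K * q : ℕ) + 1) ^ (2 * m + 7) * Real.exp (-c * (K * q : ℕ))) := by
  have hq0 : 0 < q := by omega
  have hr2 : r < 1 / 2 := hr.trans_le (rmaGrowthBound_le_half _ _)
  obtain ⟨C, ε, hC, hε, hlin⟩ := linBounded hq m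
  obtain ⟨δ, hδ, hneg⟩ := exists_relaxed_bound hr hε
  obtain ⟨N₁, hN₁⟩ := transProb_le_exp (τ := δ / (2 * (m + 3))) (by positivity)
  obtain ⟨N₂, hN₂⟩ := exists_nat_gt (1 / δ)
  refine ⟨C, ε, δ / 2, hC, hε, half_pos hδ, max N₁ N₂, fun K T hK hN hT => ?_⟩
  have hNpos : 0 < K * q := Nat.mul_pos hK hq0
  set N := K * q with hNdef
  have hNr : (0 : ℝ) < N := by exact_mod_cast hNpos
  have hNδ : 1 / (N : ℝ) ≤ δ := by
    have : (N₂ : ℝ) ≤ N := by exact_mod_cast (le_max_right N₁ N₂).trans hN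
    rw [div_lt_iff₀ hδ] at hN₂
    rw [div_le_iff₀ hNr]
    nlinarith
  have hstep := hN₁ N ((le_max_left _ _).trans hN)
  have hθ0 : 0 ≤ 4 * r * (1 - r) := by nlinarith
  have hθ1 : 4 * r * (1 - r) ≤ 1 := four_mul_le_one r
  set s := {h ∈ Finset.range (N + 1) | ((h : ℕ) : ℝ) ≤ r * N}
  have hscard : (s.card : ℝ) ≤ N + 1 := by
    have := Finset.card_filter_le (Finset.range (N + 1)) (fun h => (h : ℝ) ≤ r * N)
    rw [Finset.card_range] at this
    exact_mod_cast this
  have hE := meanCount_nonneg q K (m + 2)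
  have hP := transProb_nonneg N
  set B₁ : ℝ := C * (T / N) with hB₁
  set B₂ : ℝ := C * (2 * (N + 1) ^ 2 * (4 * r * (1 - r)) ^ (T / 2)) with hB₂
  set B₃ : ℝ := ((N : ℝ) + 1) ^ (2 * m + 6) * Real.exp (-(δ / 2) * N) with hB₃
  have hB₁0 : 0 ≤ B₁ := by positivity
  have hB₂0 : 0 ≤ B₂ := by positivity
  have hB₃0 : 0 ≤ B₃ := by positivity
  have hterm : ∀ w ∈ Finset.range (N + 1),
      ∑ h ∈ s, meanCount q K (m + 2) w * transProb N w h
        ≤ (if w ∈ Finset.range (T + 1) then B₁ else 0) + (B₂ + B₃) := by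
    intro w hw
    have hwN : w ≤ N := Nat.lt_succ_iff.1 (Finset.mem_range.1 hw)
    rcases le_or_gt (w : ℝ) (ε * N) with hwε | hwε
    · have hEw := hlin K w hK hwε
      rw [← hNdef] at hEw
      rcases Nat.lt_or_ge T w with hTw | hTw
      · -- small order: the last transition is unlikely
        rw [if_neg (by simp; omega), zero_add, ← Finset.mul_sum]
        have hE1 : meanCount q K (m + 2) w ≤ C := by
          refine hEw.trans (mul_le_of_le_one_right hC ?_)
          rw [div_le_one hNr]; exact_mod_cast hwN
        have hPsum : ∑ h ∈ s, transProb N w h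
            ≤ 2 * (N + 1) ^ 2 * (4 * r * (1 - r)) ^ (T / 2) := by
          have hone : ∀ h ∈ s, transProb N w h ≤ 2 * (N + 1) * (4 * r * (1 - r)) ^ (T / 2) := by
            intro h hh
            have hhr := (Finset.mem_filter.1 hh).2
            rcases Nat.eq_zero_or_pos h with rfl | h0
            · have : transProb N w 0 = 0 := by
                by_contra hne
                have := (le_of_transProb_ne_zero (by omega) hne).1
                omega
              rw [this]; positivity
            · refine (transProb_le_geom h0 hr2.le hhr).trans ?_
              refine mul_le_mul_of_nonneg_left ?_ (by positivity)
              exact pow_le_pow_of_le_one hθ0 hθ1 (by omega)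
          calc ∑ h ∈ s, transProb N w h
              ≤ s.card * (2 * (N + 1) * (4 * r * (1 - r)) ^ (T / 2)) := by
                rw [← nsmul_eq_mul]; exact Finset.sum_le_card_nsmul _ _ _ hone
            _ ≤ (N + 1) * (2 * (N + 1) * (4 * r * (1 - r)) ^ (T / 2)) := by gcongr
            _ = _ := by ring
        have : meanCount q K (m + 2) w * ∑ h ∈ s, transProb N w h ≤ B₂ :=
          mul_le_mul hE1 hPsum (Finset.sum_nonneg fun h _ => hP w h) hC
        linarith
      · -- weights up to `T`: few such inputs are expected
        rw [if_pos (by simp; omega), ← Finset.mul_sum]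
        have : meanCount q K (m + 2) w * ∑ h ∈ s, transProb N w h ≤ B₁ := by
          refine (mul_le_of_le_one_right (hE w) (sum_transProb_le_one N w s)).trans (hEw.trans ?_)
          rw [hB₁]
          gcongr
        linarith
    · -- linear order: the exponent is negative
      have hone : ∀ h ∈ s, meanCount q K (m + 2) w * transProb N w h
          ≤ ((N : ℝ) + 1) ^ (2 * m + 5) * Real.exp (-(δ / 2) * N) := by
        intro h hh
        have hhN : h ≤ N := Nat.lt_succ_iff.1 (Finset.mem_range.1 (Finset.mem_filter.1 hh).1)
        have hhr := (Finset.mem_filter.1 hh).2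
        by_cases hne : meanCount q K (m + 2) w * transProb N w h = 0
        · rw [hne]; positivity
        obtain ⟨γ, hγ⟩ := exists_chainBound hq0 hK hstep (m + 2) w hwN (left_ne_zero_of_mul hne)
        have hlast := hγ.2.1
        obtain ⟨hreg, hl, hx⟩ :=
          hγ.snoc hNpos hhN (right_ne_zero_of_mul hne) (hstep w hwN h hhN)
        have hexp := hneg _ (relaxedRegion_mono hNδ hreg)
          (by rw [hl, div_le_iff₀ hNr]; exact hhr)
          (by rw [Fin.snoc_castSucc, hlast, le_div_iff₀ hNr]; exact hwε.le)
        refine hx.trans ?_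
        rw [show 2 * (m + 2) + 1 = 2 * m + 5 by ring]
        refine mul_le_mul_of_nonneg_left (Real.exp_le_exp.2 ?_) (by positivity)
        have hτ : (((m + 2 + 1 : ℕ) : ℝ)) * (δ / (2 * (m + 3))) = δ / 2 := by
          push_cast; field_simp; ring
        rw [hτ]
        nlinarith
      have h1 : ∑ h ∈ s, meanCount q K (m + 2) w * transProb N w h ≤ B₃ := by
        calc _ ≤ s.card * (((N : ℝ) + 1) ^ (2 * m + 5) * Real.exp (-(δ / 2) * N)) := by
              rw [← nsmul_eq_mul]; exact Finset.sum_le_card_nsmul _ _ _ hone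
          _ ≤ (N + 1) * (((N : ℝ) + 1) ^ (2 * m + 5) * Real.exp (-(δ / 2) * N)) := by gcongr
          _ = B₃ := by rw [hB₃]; ring
      have h2 : 0 ≤ if w ∈ Finset.range (T + 1) then B₁ else 0 := by split_ifs <;> positivity
      linarith
  calc ∑ h ∈ s, meanCount q K (m + 3) h
      = ∑ w ∈ Finset.range (N + 1), ∑ h ∈ s, meanCount q K (m + 2) w * transProb N w h := by
        rw [Finset.sum_comm]
        exact Finset.sum_congr rfl fun h _ => meanCount_succ q K (m + 2) h
    _ ≤ ∑ w ∈ Finset.range (N + 1), ((if w ∈ Finset.range (T + 1) then B₁ else 0) + (B₂ + B₃)) :=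
        Finset.sum_le_sum hterm
    _ = ((Finset.range (N + 1) ∩ Finset.range (T + 1)).card : ℝ) * B₁ + (N + 1) * (B₂ + B₃) := by
        rw [Finset.sum_add_distrib, Finset.sum_ite_mem, Finset.sum_const, Finset.sum_const,
          Finset.card_range, nsmul_eq_mul, nsmul_eq_mul]
        push_cast
        ring
    _ ≤ (T + 1) * B₁ + (N + 1) * (B₂ + B₃) := by
        have : (Finset.range (N + 1) ∩ Finset.range (T + 1)).card ≤ T + 1 :=
          (Finset.card_le_card Finset.inter_subset_right).trans (by rw [Finset.card_range])
        have : ((Finset.range (N + 1) ∩ Finset.range (T + 1)).card : ℝ) ≤ T + 1 := by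
          exact_mod_cast this
        gcongr
    _ = _ := by rw [hB₂, hB₃]; ring

/-- With the threshold `T = ⌊N ^ (1 / 4)⌋` all three contributions vanish in the limit. -/
theorem tendsto_sum_meanCount {q m : ℕ} (hq : 2 ≤ q) {r : ℝ} (hr0 : 0 < r)
    (hr : r < rmaGrowthBound q (m + 3)) :
    Tendsto (fun K : ℕ => ∑ h ∈ Finset.range (K * q + 1) with ((h : ℕ) : ℝ) ≤ r * (K * q : ℕ),
      meanCount q K (m + 3) h) atTop (𝓝 0) := by
  obtain ⟨C, ε, c, hC, hε, hc, N₀, hb⟩ := sum_meanCount_le hq hr0 hr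
  have hr2 : r < 1 / 2 := hr.trans_le (rmaGrowthBound_le_half _ _)
  set θ := 4 * r * (1 - r) with hθ
  have hθ0 : 0 ≤ θ := by rw [hθ]; nlinarith
  have hθ1 : θ < 1 := by
    rw [hθ]; nlinarith [sq_pos_of_pos (show 0 < 1 - 2 * r by linarith)]
  have hKq : Tendsto (fun K : ℕ => K * q) atTop atTop :=
    tendsto_id.atTop_mul_const' (by omega)
  set j : ℕ → ℕ := fun N => Nat.sqrt (Nat.sqrt N) / 2 with hj
  have hjt : Tendsto j atTop atTop := tendsto_atTop_atTop.2 fun b =>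
    ⟨((b * 2) ^ 2) ^ 2, fun N hN => by
    rw [hj, Nat.le_div_iff_mul_le (by norm_num), Nat.le_sqrt', Nat.le_sqrt']
    exact hN⟩
  have hexp0 : Real.exp (-c) < 1 := by rw [Real.exp_lt_one_iff]; linarith
  have hg : Tendsto (fun N : ℕ => C * (1 / (j N : ℝ)) +
      (C * (2 * 4 ^ 12) * ((j N : ℝ) ^ 12 * θ ^ j N)
      + 2 ^ (2 * m + 7) * ((N : ℝ) ^ (2 * m + 7) * Real.exp (-c) ^ N))) atTop (𝓝 0) := by
    have t1 : Tendsto (fun N : ℕ => C * (1 / (j N : ℝ))) atTop (𝓝 (C * 0)) :=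
      (tendsto_one_div_atTop_nhds_zero_nat.comp hjt).const_mul C
    have t2 : Tendsto (fun N : ℕ => C * (2 * 4 ^ 12) * ((j N : ℝ) ^ 12 * θ ^ j N)) atTop
        (𝓝 (C * (2 * 4 ^ 12) * 0)) :=
      ((tendsto_pow_const_mul_const_pow_of_abs_lt_one 12
        (by rw [abs_of_nonneg hθ0]; exact hθ1)).comp hjt).const_mul _
    have t3 : Tendsto (fun N : ℕ => (2 : ℝ) ^ (2 * m + 7) *
        ((N : ℝ) ^ (2 * m + 7) * Real.exp (-c) ^ N)) atTop (𝓝 (2 ^ (2 * m + 7) * 0)) :=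
      (tendsto_pow_const_mul_const_pow_of_abs_lt_one (2 * m + 7)
        (by rw [abs_of_pos (Real.exp_pos _)]; exact hexp0)).const_mul _
    simpa using t1.add (t2.add t3)
  refine squeeze_zero' (Eventually.of_forall fun K => Finset.sum_nonneg fun h _ =>
    meanCount_nonneg _ _ _ _) ?_ (hg.comp hKq)
  obtain ⟨n₁, hn₁⟩ := exists_nat_gt (1 / ε)
  filter_upwards [eventually_gt_atTop 0, hKq.eventually_ge_atTop N₀,
    (hjt.comp hKq).eventually_ge_atTop (n₁ + 1)] with K hK hN hjK
  simp only [Function.comp_apply] at hjK ⊢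
  set N := K * q with hNdef
  have hNpos : 0 < N := Nat.mul_pos hK (by omega)
  have hNr : (0 : ℝ) < N := by exact_mod_cast hNpos
  set T := Nat.sqrt (Nat.sqrt N)
  have hjT : j N = T / 2 := rfl
  have hj1 : 1 ≤ j N := by omega
  have hjr : (1 : ℝ) ≤ j N := by exact_mod_cast hj1
  have hT4 : T ^ 4 ≤ N := by
    calc T ^ 4 = (T ^ 2) ^ 2 := by ring
      _ ≤ (Nat.sqrt N) ^ 2 := Nat.pow_le_pow_left (Nat.sqrt_le' _) 2
      _ ≤ N := Nat.sqrt_le' _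
  have hN4 : N + 1 ≤ (T + 1) ^ 4 := by
    calc N + 1 ≤ (Nat.sqrt N + 1) ^ 2 := Nat.lt_succ_sqrt' N
      _ ≤ ((T + 1) ^ 2) ^ 2 := Nat.pow_le_pow_left (Nat.lt_succ_sqrt' _) 2
      _ = _ := by ring
  have hT4r : (T : ℝ) ^ 4 ≤ N := by exact_mod_cast hT4
  have hTj : 2 * (j N : ℝ) ≤ T := by exact_mod_cast (by omega : 2 * j N ≤ T)
  have hT1 : (1 : ℝ) ≤ T := by linarith
  have hTε : (T : ℝ) ≤ ε * N := by
    have h1 : (n₁ : ℝ) ≤ T := by exact_mod_cast (by omega : n₁ ≤ T)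
    rw [div_lt_iff₀ hε] at hn₁
    have h2 : 1 ≤ ε * T := by nlinarith
    have h3 : (T : ℝ) * T ≤ T ^ 4 := by
      rw [← pow_two]; exact pow_le_pow_right₀ hT1 (by norm_num)
    nlinarith
  refine (hb K T hK hN hTε).trans (add_le_add ?_ (add_le_add ?_ ?_))
  · have h1 : ((T : ℝ) + 1) * (C * (T / N)) = C * (((T : ℝ) + 1) * T / N) := by ring
    rw [h1]
    refine mul_le_mul_of_nonneg_left ?_ hC
    rw [div_le_div_iff₀ hNr (by linarith)]
    have h2 : (T : ℝ) ^ 3 ≤ T ^ 4 := pow_le_pow_right₀ hT1 (by norm_num)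
    have h3 : ((T : ℝ) + 1) * T * j N ≤ (2 * T) * T * (T / 2) := by
      gcongr <;> linarith
    nlinarith
  · rw [mul_assoc C]
    refine mul_le_mul_of_nonneg_left ?_ hC
    have h1 : ((N : ℝ) + 1) ^ 3 ≤ 4 ^ 12 * (j N : ℝ) ^ 12 := by
      have h2 : (N : ℝ) + 1 ≤ (T + 1) ^ 4 := by exact_mod_cast hN4
      have h3 : (T : ℝ) + 1 ≤ 4 * j N := by exact_mod_cast (by omega : T + 1 ≤ 4 * j N)
      calc ((N : ℝ) + 1) ^ 3 ≤ (((4 * j N : ℝ)) ^ 4) ^ 3 := by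
            refine pow_le_pow_left₀ (by positivity) (h2.trans ?_) 3
            exact pow_le_pow_left₀ (by positivity) h3 4
        _ = _ := by ring
    calc 2 * ((N : ℝ) + 1) ^ 3 * θ ^ (T / 2) ≤ 2 * (4 ^ 12 * (j N : ℝ) ^ 12) * θ ^ (T / 2) := by
          gcongr
      _ = _ := by rw [hjT]; ring
  · have h1 : Real.exp (-c * N) = Real.exp (-c) ^ N := by
      rw [← Real.exp_nat_mul]; ring_nf
    rw [h1, ← mul_assoc, ← mul_pow]
    refine mul_le_mul_of_nonneg_right (pow_le_pow_left₀ (by positivity) ?_ _) (by positivity)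
    have : (1 : ℝ) ≤ N := by exact_mod_cast hNpos
    linarith

lemma rmaFraction_le_one (q M K : ℕ) (P : Set (Fin (K * q) → ZMod 2) → Prop) :
    rmaFraction q M K P ≤ 1 := by
  unfold rmaFraction
  refine div_le_one_of_le₀ ?_ (by positivity)
  exact_mod_cast Finite.card_subtype_le _

theorem tendsto_rmaFraction {q M : ℕ} (hq : 2 ≤ q) (hM : 3 ≤ M) {r : ℝ}
    (hr : r < rmaGrowthBound q M) :
    Tendsto (fun K : ℕ => rmaFraction q M K
      (fun C => r * ((K * q : ℕ) : ℝ) ≤ (codeMinDist C : ℝ))) atTop (𝓝 1) := by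
  obtain ⟨m, rfl⟩ : ∃ m, M = m + 3 := ⟨M - 3, by omega⟩
  have hpos : 0 < rmaGrowthBound q (m + 3) := rmaGrowthBound_pos hq (by omega)
  -- it is enough to consider a positive threshold
  have ht := (tendsto_sum_meanCount hq (lt_max_of_lt_right (half_pos hpos))
    (max_lt hr (half_lt_self hpos))).const_sub 1
  rw [sub_zero] at ht
  refine tendsto_of_tendsto_of_tendsto_of_le_of_le' ht tendsto_const_nhds ?_
    (Eventually.of_forall fun K => rmaFraction_le_one _ _ _ _)
  filter_upwards [eventually_gt_atTop 0] with K hK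
  have := one_sub_rmaFraction_le (q := q) (M := m + 3) (by omega) hK (r * ((K * q : ℕ) : ℝ))
    {h ∈ Finset.range (K * q + 1) |
      ((h : ℕ) : ℝ) ≤ max r (rmaGrowthBound q (m + 3) / 2) * (K * q : ℕ)}
    fun h hh hx => Finset.mem_filter.2 ⟨Finset.mem_range.2 (Nat.lt_succ_of_le hh),
      hx.le.trans (mul_le_mul_of_nonneg_right (le_max_left _ _) (by positivity))⟩
  linarith

end RMA

theorem theorem3 (q M : ℕ) (hq : 2 ≤ q) (hM : 3 ≤ M) :
    -- the growth rate bound is positive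
    0 < rmaGrowthBound q M ∧
    -- almost all codes have minimum distance at least `r N`, for every `r` below the bound
    (∀ r : ℝ, r < rmaGrowthBound q M →
      Filter.Tendsto
        (fun K : ℕ => rmaFraction q M K (fun C => r * ((K * q : ℕ) : ℝ) ≤ (codeMinDist C : ℝ)))
        Filter.atTop (nhds 1)) ∧
    -- the maximum of the exponent for given `ρ`: if the exponent is not everywhere negative, the
    -- maximum is attained
    (∀ ρ : ℝ, 0 < ρ → ρ ≤ 1 / 2 → (∃ γ ∈ rmaRegion M ρ, 0 ≤ rmaExponent q M γ) →
      ∃ γ ∈ rmaRegion M ρ, IsMaxOn (rmaExponent q M) (rmaRegion M ρ) γ) ∧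
    -- every maximizer solves the recursive system
    (∀ ρ : ℝ, 0 < ρ → ρ ≤ 1 / 2 → ∀ γ ∈ rmaRegion M ρ,
      IsMaxOn (rmaExponent q M) (rmaRegion M ρ) γ → SolvesRmaSystem q M γ) ∧
    -- the bound is the point where the maximum of the exponent reaches zero
    IsGreatest (rmaExponent q M '' rmaRegion M (rmaGrowthBound q M)) 0 ∧
    -- the bound is obtained by solving the system together with `f(γ) = 0`
    IsLeast {ρ : ℝ | ∃ γ : Fin (M + 1) → ℝ, SolvesRmaSystem q M γ ∧ γ (Fin.last M) = ρ ∧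
      rmaExponent q M γ = 0} (rmaGrowthBound q M) := by
  have hpos : 0 < rmaGrowthBound q M := RMA.rmaGrowthBound_pos hq (by omega)
  have hhalf := RMA.rmaGrowthBound_le_half q M
  obtain ⟨γ, hγ, hz⟩ := RMA.exists_zero hq hM
  have hle : ∀ γ' ∈ rmaRegion M (rmaGrowthBound q M), rmaExponent q M γ' ≤ 0 :=
    fun γ' => RMA.rmaExponent_nonpos
  refine ⟨hpos, fun r hr => RMA.tendsto_rmaFraction hq hM hr,
    fun ρ _ _ h => RMA.exists_isMaxOn (by omega) h,
    fun ρ h0 h1 γ' hγ' hmax => RMA.solves_of_isMaxOn (by omega) (by omega) h0 h1 hγ' hmax,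
    ⟨⟨γ, hγ, hz⟩, ?_⟩, ⟨γ, ?_, hγ.2.1, hz⟩, ?_⟩
  · rintro _ ⟨γ', hγ', rfl⟩
    exact hle γ' hγ'
  · refine RMA.solves_of_isMaxOn (by omega) (by omega) hpos hhalf hγ fun γ' hγ' => ?_
    change rmaExponent q M γ' ≤ rmaExponent q M γ
    rw [hz]
    exact hle γ' hγ'
  · rintro _ ⟨γ', hs, rfl, hz'⟩
    have hmem := RMA.mem_rmaRegion_of_solves hs
    by_contra hn
    have := RMA.rmaExponent_neg (RMA.last_pos (RMA.rmaRegion_subset hmem) hmem.1)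
      (not_le.1 hn) hmem
    linarith
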